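/- Let $p_1=2<p_2=3<\dots$ denote the primes, and for real $x,H$ put $$N(x,H)=\sum_{\substack{p_{n+1}\le x\\ p_{n+1}-p_n\ge H}}1,\qquad S(x,H)=\sum_{\substack{p_{n+1}\le x\\ p_{n+1}-p_n\ge H}}(p_{n+1}-p_n).$$ For a finite set $\mathcal H$ of $k$ nonnegative integers let $\pi(x;\mathcal H)$ be the number of positive integers $n\le x$ such that $n+a$ is prime for every $a\in\mathcal H$, let $\nu_{\mathcal H}(p)$ be the number of residue classes modulo $p$ occupied by $\mathcal H$, call $\mathcal H$ admissible if $\nu_{\mathcal H}(p)<p$ for all primes $p$, and let $\mathfrak S(\mathcal H)=\prod_p(1-1/p)^{-k}(1-\nu_{\mathcal H}(p)/p)$. Assume the Hardy--Littlewood prime $k$-tuples conjecture in the following form: for every fixed integer $k\ge 2$, every constant $\mu>0$ and every function $h=h(x)$ with $h\sim\mu\log x$ as $x\to\infty$, $$\pi(x;\mathcal H)=\mathfrak S(\mathcal H)\,\frac{x}{\log^k x}\,(1+o(1))\qquad(x\to\infty),$$ uniformly over all admissible sets $\mathcal H\subset[1,h]$ of $k$ integers. Then for every fixed $\lambda>0$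 and every function $H=H(x)$ with $H\sim\lambda\log x$ as $x\to\infty$ (in particular for $H=\lambda\log x$), $$N(x,H)\sim e^{-\lambda}\frac{x}{\log x}\qquad\text{and}\qquad S(x,H)\sim(1+\lambda)e^{-\lambda}x\qquad(x\to\infty).$$ -/

import Mathlib

open Filter Asymptotics

noncomputable section

namespace PrimeGaps

/-! ### The Hardy–Littlewood prime `k`-tuples conjecture -/

/-- `residueCount H p` is the number `ν_H(p)` of distinct residue classes modulo `p` occupied by
the elements of `H`. -/
def residueCount (H : Finset ℕ) (p : ℕ) : ℕ :=
  (H.image (fun a => a % p)).card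

/-- `H` is admissible if it does not occupy all the residue classes modulo any prime. -/
def Admissible (H : Finset ℕ) : Prop :=
  ∀ p : ℕ, p.Prime → residueCount H p < p

/-- The factor at `p` of the singular series of `H`, with `k = #H`. -/
def singularFactor (H : Finset ℕ) (p : ℕ) : ℝ :=
  ((1 - 1 / (p : ℝ)) ^ H.card)⁻¹ * (1 - (residueCount H p : ℝ) / p)

/-- The singular series `𝔖(H)`, a product over all primes; it converges absolutely,
see `multipliable_singularFactor`. -/
def singularSeries (H : Finset ℕ) : ℝ :=
  ∏' p : Nat.Primes, singularFactor H p

/-- `tupleCount x H` is `π(x; H)`: the number of positive integers `n ≤ x` such that all the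
`n + a`, for `a ∈ H`, are prime. -/
def tupleCount (x : ℝ) (H : Finset ℕ) : ℕ :=
  ((Finset.Icc 1 ⌊x⌋₊).filter (fun n => ∀ a ∈ H, (n + a).Prime)).card

/-- The Hardy–Littlewood prime `k`-tuples conjecture: for every fixed `k ≥ 2`,
`π(x; H) = 𝔖(H) x / (log x) ^ k * (1 + o(1))` as `x → ∞`, uniformly for the admissible sets `H` of
`k` integers with `H ⊆ [1, h]`, whenever `h ∼ μ log x` for a positive constant `μ`. -/
def HardyLittlewoodConjecture : Prop :=
  ∀ k : ℕ, 2 ≤ k → ∀ μ : ℝ, 0 < μ → ∀ h : ℝ → ℝ,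
    h ~[atTop] (fun x => μ * Real.log x) →
    ∀ ε : ℝ, 0 < ε → ∀ᶠ x : ℝ in atTop, ∀ H : Finset ℕ,
      H.card = k → Admissible H → (∀ a ∈ H, 1 ≤ a ∧ (a : ℝ) ≤ h x) →
        |(tupleCount x H : ℝ) - singularSeries H * (x / Real.log x ^ k)|
          ≤ ε * (singularSeries H * (x / Real.log x ^ k))

/-! ### Large gaps between primes -/

/-- The prime with index `n`, counted from `prime 0 = 2`. -/
def prime (n : ℕ) : ℕ := Nat.nth Nat.Prime n

/-- The `n` with `p_{n+1} ≤ x` and `p_{n+1} - p_n ≥ H`. -/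
def largeGaps (x H : ℝ) : Set ℕ :=
  {n | (prime (n + 1) : ℝ) ≤ x ∧ H ≤ (prime (n + 1) : ℝ) - prime n}

theorem largeGaps_finite (x H : ℝ) : (largeGaps x H).Finite := by
  refine (Set.finite_Iic ⌊x⌋₊).subset fun n hn => ?_
  have h1 : n + 1 + 2 ≤ prime (n + 1) := Nat.add_two_le_nth_prime (n + 1)
  have h2 : prime (n + 1) ≤ ⌊x⌋₊ := Nat.le_floor hn.1
  exact Set.mem_Iic.2 (by omega)

/-- `N(x, H)`: the number of prime gaps of size at least `H` with `p_{n+1} ≤ x`. -/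
def gapCount (x H : ℝ) : ℝ :=
  ∑ _n ∈ (largeGaps_finite x H).toFinset, 1

/-- `S(x, H)`: the sum of the prime gaps of size at least `H` with `p_{n+1} ≤ x`. -/
def gapSum (x H : ℝ) : ℝ :=
  ∑ n ∈ (largeGaps_finite x H).toFinset, ((prime (n + 1) : ℝ) - prime n)

/-! ### Convergence of the singular series -/

theorem residueCount_eq_card (H : Finset ℕ) (p : ℕ) (hp : ∀ a ∈ H, a < p) :
    residueCount H p = H.card := by
  unfold residueCount
  refine Finset.card_image_of_injOn fun a ha b hb hab => ?_
  have e : a % p = b % p := hab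
  rwa [Nat.mod_eq_of_lt (hp a ha), Nat.mod_eq_of_lt (hp b hb)] at e

theorem abs_linear_sub_pow_le (k : ℕ) (t : ℝ) (h0 : 0 ≤ t) (h1 : t ≤ 1) :
    0 ≤ (1 - t) ^ k - (1 - k * t) ∧ (1 - t) ^ k - (1 - k * t) ≤ k ^ 2 * t ^ 2 := by
  induction k with
  | zero => simp
  | succ k ih =>
    obtain ⟨ih1, ih2⟩ := ih
    have e : (1 - t) ^ (k + 1) - (1 - (↑(k + 1) : ℝ) * t)
        = (1 - t) * ((1 - t) ^ k - (1 - k * t)) + k * t ^ 2 := by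
      push_cast; ring
    have hk : (0 : ℝ) ≤ k := Nat.cast_nonneg k
    rw [e]
    constructor
    · have := mul_nonneg (sub_nonneg.2 h1) ih1
      positivity
    · have h2 : (1 - t) * ((1 - t) ^ k - (1 - k * t)) ≤ (1 - t) ^ k - (1 - k * t) := by
        nlinarith
      push_cast
      nlinarith [sq_nonneg t, mul_nonneg hk (sq_nonneg t)]

theorem multipliable_singularFactor (H : Finset ℕ) :
    Multipliable (fun p : Nat.Primes => singularFactor H p) := by
  have key : Summable (fun p : Nat.Primes => singularFactor H p - 1) := by
    have hs : Summable (fun p : Nat.Primes =>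
        (2 : ℝ) ^ H.card * (H.card : ℝ) ^ 2 * (1 / ((p : ℕ) : ℝ) ^ 2)) :=
      ((Real.summable_one_div_nat_pow.2 one_lt_two).comp_injective
        Subtype.coe_injective).mul_left _
    refine hs.of_norm_bounded_eventually ?_
    have hfin : {p : Nat.Primes | (p : ℕ) ≤ H.sup id}.Finite :=
      (Set.finite_Iic (H.sup id)).preimage Subtype.coe_injective.injOn
    refine hfin.eventually_cofinite_notMem.mono fun p hp => ?_
    have hlt : ∀ a ∈ H, a < (p : ℕ) := fun a ha =>
      lt_of_le_of_lt (Finset.le_sup (f := id) ha) (not_le.1 hp)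
    have hp2 : (2 : ℝ) ≤ ((p : ℕ) : ℝ) := by exact_mod_cast p.2.two_le
    unfold singularFactor
    rw [residueCount_eq_card H p hlt]
    set t : ℝ := 1 / ((p : ℕ) : ℝ) with ht
    have ht0 : 0 ≤ t := by positivity
    have ht2 : t ≤ 1 / 2 := one_div_le_one_div_of_le two_pos hp2
    have e1 : (H.card : ℝ) / ((p : ℕ) : ℝ) = H.card * t := by rw [ht]; ring
    have e2 : 1 / ((p : ℕ) : ℝ) ^ 2 = t ^ 2 := by rw [ht]; ring
    rw [e1, e2]
    obtain ⟨b1, b2⟩ := abs_linear_sub_pow_le H.card t ht0 (by linarith)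
    have hpos : 0 < (1 - t) ^ H.card := pow_pos (by linarith) _
    have hinv : ((1 - t) ^ H.card)⁻¹ ≤ 2 ^ H.card := by
      rw [← inv_pow]
      refine pow_le_pow_left₀ (inv_nonneg.2 (by linarith)) ?_ _
      exact inv_le_of_inv_le₀ two_pos (by linarith)
    have e3 : ((1 - t) ^ H.card)⁻¹ * (1 - H.card * t) - 1
        = -(((1 - t) ^ H.card)⁻¹ * ((1 - t) ^ H.card - (1 - H.card * t))) := by
      field_simp
      ring
    rw [e3, norm_neg, Real.norm_of_nonneg (mul_nonneg (inv_nonneg.2 hpos.le) b1), mul_assoc]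
    exact mul_le_mul hinv b2 b1 (by positivity)
  have := Real.multipliable_one_add_of_summable key
  simpa using this

end PrimeGaps

end

namespace PrimeGaps

open Finset Topology

/-! ### Counting subsets and shifts coprime to a squarefree modulus -/

/-! Under the conjecture the number `X` of primes in a window `(n, n + μ log x]`, for random `n ≤
x`, is Poisson with mean `μ` in the limit; gaps are then read off from the windows without primes.

Poisson law. The average of `X.choose k` is a sum of `tupleCount` over `k`-subsets of `[1, h]`, with
`h` the integer part of `μ log x`. For `k ≥ 2` the conjecture turns it into a sum of singular
series, and Gallagher's theorem (`tendsto_sum_singularSeries`) gives the limit `μ ^ k / k!`. For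
that theorem the Euler product is cut at a height `y` of order `log h`: the head is the density of a
sieve and is averaged exactly, up to edge effects of size `primorial y`; the tail is uniformly close
to `1`. The case `k = 1` is the prime number theorem, which is not assumed: Cauchy–Schwarz with the
second and third moments locates the first moment within `1` of `μ`, and large `μ` makes this
relatively negligible. Bonferroni's inequalities then give `exp (-μ) * x` empty windows
(`tendsto_emptyWindowCount`).

Gaps. A gap of length `g` contains `max (g - h) 0` starting points of empty windows, so the total
excess of the gaps over `h` is asymptotic to `exp (-μ) * x`. As a function of `h` this excess is
convex, with slope minus the number of gaps longer than `h`; difference quotients in `μ` therefore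
give the count (`tendsto_longGapCount`). The sum of the long gaps is the excess plus `h` times the
count. Monotonicity in the threshold extends both results to every `H ∼ λ log x`. -/

theorem sum_powersetCard_ite (S : Finset ℕ) (q : ℕ → Prop) [DecidablePred q] (k : ℕ) :
    ∑ D ∈ S.powersetCard k, (if ∀ a ∈ D, q a then 1 else 0) = (#{a ∈ S | q a}).choose k := by
  rw [← card_filter, ← card_powersetCard]
  congr 1
  ext D
  simp only [mem_filter, mem_powersetCard, subset_iff]
  grind

/-- The number of residues `z` modulo `Q` such that all the `z + a`, for `a ∈ D`, are units. -/
noncomputable def unitShiftCount (Q : ℕ) (D : Finset ℕ) : ℕ :=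
  Nat.card {z : ZMod Q // ∀ a ∈ D, IsUnit (z + (a : ZMod Q))}

theorem unitShiftCount_one (D : Finset ℕ) : unitShiftCount 1 D = 1 := by
  unfold unitShiftCount
  rw [Nat.card_eq_one_iff_unique]
  refine ⟨⟨fun a b => Subtype.ext (Subsingleton.elim (α := ZMod 1) _ _)⟩, ⟨⟨0, fun a _ => ?_⟩⟩⟩
  exact @isUnit_of_subsingleton (ZMod 1) _ (inferInstanceAs (Subsingleton (Fin 1))) _

theorem unitShiftCount_mul {m n : ℕ} (h : m.Coprime n) (D : Finset ℕ) :
    unitShiftCount (m * n) D = unitShiftCount m D * unitShiftCount n D := by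
  unfold unitShiftCount
  rw [← Nat.card_prod]
  let e := ZMod.chineseRemainder h
  have key : ∀ z : ZMod (m * n), (∀ a ∈ D, IsUnit (z + (a : ZMod (m * n)))) ↔
      (∀ a ∈ D, IsUnit ((e z).1 + (a : ZMod m))) ∧ ∀ a ∈ D, IsUnit ((e z).2 + (a : ZMod n)) := by
    intro z
    rw [← forall₂_and]
    refine forall₂_congr fun a _ => ?_
    rw [← MulEquiv.isUnit_map e, map_add, map_natCast, Prod.isUnit_iff]
    simp
  refine Nat.card_congr ((e.toEquiv.subtypeEquiv
    (q := fun w => (∀ a ∈ D, IsUnit (w.1 + (a : ZMod m))) ∧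
      ∀ a ∈ D, IsUnit (w.2 + (a : ZMod n))) key).trans ?_)
  exact Equiv.subtypeProdEquivProd (p := fun x : ZMod m => ∀ a ∈ D, IsUnit (x + (a : ZMod m)))
    (q := fun y : ZMod n => ∀ a ∈ D, IsUnit (y + (a : ZMod n)))

theorem residueCount_le (D : Finset ℕ) {p : ℕ} (hp : 0 < p) : residueCount D p ≤ p := by
  unfold residueCount
  calc _ ≤ #(range p) := card_le_card fun x hx => by
        obtain ⟨a, -, rfl⟩ := mem_image.1 hx
        exact mem_range.2 (Nat.mod_lt _ hp)
    _ = p := card_range p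

theorem residueCount_le_card (D : Finset ℕ) (p : ℕ) : residueCount D p ≤ #D := card_image_le

/-- The field `ZMod p` has only `0` as a non-unit, so the forbidden `z` are the classes `-a`, and
there are `residueCount D p` of them. -/
theorem unitShiftCount_prime {p : ℕ} (hp : p.Prime) (D : Finset ℕ) :
    unitShiftCount p D = p - residueCount D p := by
  have := Fact.mk hp
  have h1 : residueCount D p = #(D.image fun a : ℕ => -(a : ZMod p)) := by
    unfold residueCount
    rw [show (D.image fun a : ℕ => -(a : ZMod p))
      = (D.image (fun a => a % p)).image (fun r : ℕ => -(r : ZMod p)) by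
        rw [image_image]; congr 1; ext a; simp]
    refine (card_image_of_injOn ?_).symm
    intro r hr s hs hrs
    simp only [coe_image, Set.mem_image, mem_coe] at hr hs
    obtain ⟨a, -, rfl⟩ := hr
    obtain ⟨b, -, rfl⟩ := hs
    have := neg_injective hrs
    rw [ZMod.natCast_eq_natCast_iff'] at this
    simpa using this
  unfold unitShiftCount
  rw [h1, Nat.card_eq_fintype_card, Fintype.card_subtype]
  rw [show ∀ S : Finset (ZMod p), p - #S = #Sᶜ by intro S; rw [card_compl, ZMod.card]]
  congr 1
  ext z
  simp only [mem_filter, mem_univ, true_and, isUnit_iff_ne_zero, mem_compl, mem_image, not_exists,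
    not_and]
  refine forall₂_congr fun a _ => not_congr ?_
  rw [add_eq_zero_iff_eq_neg, eq_comm]

theorem unitShiftCount_prod (s : Finset ℕ) (hs : ∀ p ∈ s, p.Prime) (D : Finset ℕ) :
    unitShiftCount (∏ p ∈ s, p) D = ∏ p ∈ s, (p - residueCount D p) := by
  induction s using Finset.induction_on with
  | empty => simpa using unitShiftCount_one D
  | insert p s hps ih =>
    rw [prod_insert hps, prod_insert hps, unitShiftCount_mul,
      ih fun q hq => hs q (mem_insert_of_mem hq), unitShiftCount_prime (hs p (mem_insert_self _ _))]
    refine Nat.Coprime.prod_right fun q hq => ?_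
    refine (Nat.coprime_primes (hs p (mem_insert_self _ _)) (hs q (mem_insert_of_mem hq))).2 ?_
    rintro rfl
    exact hps hq

theorem card_filter_coprime_Ico_mul (P m q : ℕ) :
    #{x ∈ Ico m (m + P * q) | P.Coprime x} = P.totient * q := by
  induction q with
  | zero => simp
  | succ q ih =>
    have h := Nat.filter_coprime_Ico_eq_totient P (m + P * q)
    rw [← Ico_union_Ico_eq_Ico (show m ≤ m + P * q by omega)
      (show m + P * q ≤ m + P * (q + 1) by rw [mul_add]; omega), filter_union,
      card_union_of_disjoint, ih, show m + P * (q + 1) = m + P * q + P by ring, h]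
    · ring
    · exact disjoint_filter_filter (Ico_disjoint_Ico_consecutive _ _ _)

/-- Each full period of length `P` contributes exactly `P.totient`; only the incomplete period at
the end produces an error. -/
theorem abs_card_filter_coprime_Ico_sub_le {P : ℕ} (hP : 0 < P) (m h : ℕ) :
    |(#{x ∈ Ico m (m + h) | P.Coprime x} : ℝ) - h * ((P.totient : ℝ) / P)| ≤ P := by
  have hu := Nat.Ico_filter_coprime_le m h hP.ne'
  have hl : P.totient * (h / P) ≤ #{x ∈ Ico m (m + h) | P.Coprime x} := by
    rw [← card_filter_coprime_Ico_mul P m (h / P)]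
    refine card_le_card (filter_subset_filter _ (Ico_subset_Ico_right ?_))
    have := Nat.mul_div_le h P
    omega
  have hφ : (P.totient : ℝ) ≤ P := by exact_mod_cast Nat.totient_le P
  have hP' : (0 : ℝ) < P := by exact_mod_cast hP
  have e : (h : ℝ) = P * (h / P : ℕ) + (h % P : ℕ) := by exact_mod_cast (Nat.div_add_mod h P).symm
  have hr : ((h % P : ℕ) : ℝ) ≤ P := by exact_mod_cast (Nat.mod_lt h hP).le
  have e2 : h * ((P.totient : ℝ) / P)
      = P.totient * (h / P : ℕ) + P.totient * ((h % P : ℕ) / P) := by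
    conv_lhs => rw [e]
    field_simp
  have h3 : 0 ≤ (P.totient : ℝ) * ((h % P : ℕ) / P) := by positivity
  have h4 : (P.totient : ℝ) * ((h % P : ℕ) / P) ≤ P.totient :=
    mul_le_of_le_one_right (by positivity) ((div_le_one hP').2 hr)
  have hu' : (#{x ∈ Ico m (m + h) | P.Coprime x} : ℝ) ≤ P.totient * ((h / P : ℕ) + 1) := by
    exact_mod_cast hu
  have hl' : (P.totient : ℝ) * (h / P : ℕ) ≤ #{x ∈ Ico m (m + h) | P.Coprime x} := by
    exact_mod_cast hl
  rw [e2, abs_le]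
  constructor <;> linarith

/-! ### The truncated singular series -/

/-- The product of the factors of the singular series at the primes up to `y`. -/
noncomputable def truncatedSeries (y : ℕ) (D : Finset ℕ) : ℝ :=
  ∏ p ∈ Nat.primesLE y, singularFactor D p

theorem prod_one_sub_primesLE (y : ℕ) :
    ∏ p ∈ Nat.primesLE y, (1 - 1 / (p : ℝ)) = (primorial y).totient / primorial y := by
  have h := congrArg (fun q : ℚ => (q : ℝ)) (Nat.totient_eq_mul_prod_factors (primorial y))
  have h0 : (primorial y : ℝ) ≠ 0 := by exact_mod_cast primorial_ne_zero y
  rw [eq_div_iff h0]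
  rw [primeFactors_primorial] at h
  push_cast at h
  rw [h, mul_comm]
  simp [one_div]

/-- By the Chinese remainder theorem the local densities multiply to the proportion of shifts `z`
modulo the primorial for which all the `z + a` are coprime to it. -/
theorem truncatedSeries_eq (y : ℕ) (D : Finset ℕ) :
    truncatedSeries y D = ((((primorial y).totient : ℝ) / primorial y) ^ #D)⁻¹ *
      ((unitShiftCount (primorial y) D : ℝ) / primorial y) := by
  unfold truncatedSeries singularFactor
  rw [prod_mul_distrib, prod_inv_distrib, prod_pow, prod_one_sub_primesLE]
  congr 1
  rw [primorial_eq_prod_primesLE, unitShiftCount_prod _ fun p hp => Nat.prime_of_mem_primesLE hp]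
  push_cast
  rw [← prod_div_distrib]
  refine prod_congr rfl fun p hp => ?_
  have hp' := Nat.prime_of_mem_primesLE hp
  have : (p : ℝ) ≠ 0 := by exact_mod_cast hp'.ne_zero
  rw [Nat.cast_sub (residueCount_le D hp'.pos)]
  field_simp

/-- Exchange the sums: for fixed `z`, the admitted `D` are the `k`-subsets of those `a` for which `z
+ a` is coprime to `P`. -/
theorem sum_unitShiftCount (P : ℕ) [NeZero P] (k h : ℕ) :
    ∑ D ∈ (Icc 1 h).powersetCard k, unitShiftCount P D
      = ∑ z : ZMod P, (#{x ∈ Ico (z.val + 1) (z.val + 1 + h) | P.Coprime x}).choose k := by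
  classical
  have h1 : ∀ D : Finset ℕ, unitShiftCount P D
      = ∑ z : ZMod P, if ∀ a ∈ D, P.Coprime (z.val + a) then 1 else 0 := by
    intro D
    unfold unitShiftCount
    rw [Nat.card_eq_fintype_card, Fintype.card_subtype, card_filter]
    refine sum_congr rfl fun z _ => if_congr (forall₂_congr fun a _ => ?_) rfl rfl
    rw [Nat.coprime_comm, ← ZMod.isUnit_iff_coprime]
    simp
  simp_rw [h1]
  rw [sum_comm]
  refine sum_congr rfl fun z _ => ?_
  rw [sum_powersetCard_ite]
  congr 1
  refine card_bij (fun a _ => z.val + a) ?_ (by intros; omega) ?_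
  · intro a ha
    simp only [mem_filter, mem_Icc, mem_Ico] at ha ⊢
    exact ⟨by omega, ha.2⟩
  · intro b hb
    simp only [mem_filter, mem_Ico] at hb
    refine ⟨b - z.val, ?_, by omega⟩
    simp only [mem_filter, mem_Icc]
    refine ⟨by omega, ?_⟩
    rw [show z.val + (b - z.val) = b by omega]
    exact hb.2

/-- From `(n + 1 - k) ^ k ≤ k! * n.choose k ≤ n ^ k`; the extra `k` in `d + k` absorbs the shift on
the left. -/
theorem choose_mem_Icc_of_abs_sub_le {n k : ℕ} {X d : ℝ} (hX : 0 < X) (h : |(n : ℝ) - X| ≤ d)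
    (hd : d + k ≤ X) :
    (1 - (d + k) / X) ^ k ≤ k.factorial * (n.choose k : ℝ) / X ^ k ∧
      k.factorial * (n.choose k : ℝ) / X ^ k ≤ (1 + (d + k) / X) ^ k := by
  rw [abs_le] at h
  have hf : (0 : ℝ) < k.factorial := by exact_mod_cast k.factorial_pos
  have hd0 : (k : ℝ) ≤ d + k := by linarith
  constructor
  · rw [le_div_iff₀ (by positivity), ← mul_pow]
    have h1 := Nat.pow_le_choose (α := ℝ) k n
    rw [div_le_iff₀ hf] at h1
    have h2 : (n : ℝ) - k ≤ ((n + 1 - k : ℕ) : ℝ) := by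
      have : n ≤ n + 1 - k + k := by omega
      have : (n : ℝ) ≤ ((n + 1 - k : ℕ) : ℝ) + k := by exact_mod_cast this
      linarith
    have h3 : (1 - (d + k) / X) * X = X - d - k := by field_simp; ring
    rw [h3]
    calc (X - d - k) ^ k ≤ ((n + 1 - k : ℕ) : ℝ) ^ k :=
          pow_le_pow_left₀ (by linarith) (by linarith) _
      _ ≤ _ := by linarith
  · rw [div_le_iff₀ (by positivity), ← mul_pow]
    have h1 := Nat.choose_le_pow_div (α := ℝ) k n
    rw [le_div_iff₀ hf] at h1
    have h3 : (1 + (d + k) / X) * X = X + d + k := by field_simp; ring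
    rw [h3]
    have hk : (0 : ℝ) ≤ k := by positivity
    calc _ ≤ (n : ℝ) ^ k := by linarith
      _ ≤ _ := pow_le_pow_left₀ (by positivity) (by linarith) _

/-- The normalised sum is an average over `z` of binomial coefficients of sieve counts, each of
which is `h * φ(P) / P` up to `P`; the bounds hold for every single `z`. -/
theorem sum_truncatedSeries_mem_Icc {y k h : ℕ} (hh : 0 < h)
    (hd : ((primorial y : ℝ) + k) / (h * (((primorial y).totient : ℝ) / primorial y)) ≤ 1) :
    (1 - ((primorial y : ℝ) + k) / (h * (((primorial y).totient : ℝ) / primorial y))) ^ k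
        ≤ k.factorial * (∑ D ∈ (Icc 1 h).powersetCard k, truncatedSeries y D) / (h : ℝ) ^ k ∧
      k.factorial * (∑ D ∈ (Icc 1 h).powersetCard k, truncatedSeries y D) / (h : ℝ) ^ k
        ≤ (1 + ((primorial y : ℝ) + k) /
          (h * (((primorial y).totient : ℝ) / primorial y))) ^ k := by
  set P := primorial y with hP
  have hP0 : 0 < P := primorial_pos y
  have : NeZero P := ⟨hP0.ne'⟩
  have hPr : (0 : ℝ) < P := by exact_mod_cast hP0
  set V : ℝ := (P.totient : ℝ) / P with hV
  have hV0 : 0 < V := div_pos (by exact_mod_cast Nat.totient_pos.2 hP0) hPr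
  have hhr : (0 : ℝ) < h := by exact_mod_cast hh
  have hX : 0 < h * V := by positivity
  set N : ZMod P → ℕ := fun z => #{x ∈ Ico (z.val + 1) (z.val + 1 + h) | P.Coprime x} with hN
  have e : k.factorial * (∑ D ∈ (Icc 1 h).powersetCard k, truncatedSeries y D) / (h : ℝ) ^ k
      = (∑ z : ZMod P, k.factorial * ((N z).choose k : ℝ) / (h * V) ^ k) / P := by
    have h1 : ∑ D ∈ (Icc 1 h).powersetCard k, truncatedSeries y D
        = (V ^ k)⁻¹ * ((∑ z : ZMod P, ((N z).choose k : ℝ)) / P) := by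
      have h2 := sum_unitShiftCount P k h
      have h3 : (∑ D ∈ (Icc 1 h).powersetCard k, (unitShiftCount P D : ℝ))
        = ∑ z : ZMod P, ((N z).choose k : ℝ) := by exact_mod_cast h2
      rw [← h3, sum_div, mul_sum]
      refine sum_congr rfl fun D hD => ?_
      rw [truncatedSeries_eq, (mem_powersetCard.1 hD).2]
    rw [h1, ← sum_div, ← mul_sum, mul_pow]
    field_simp
  have hb : ∀ z, _ := fun z : ZMod P => choose_mem_Icc_of_abs_sub_le (k := k) hX
    (abs_card_filter_coprime_Ico_sub_le hP0 (z.val + 1) h) ((div_le_one hX).1 hd)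
  have hc : (Fintype.card (ZMod P) : ℝ) = P := by rw [ZMod.card]
  rw [e, le_div_iff₀ hPr, div_le_iff₀ hPr]
  constructor
  · have := card_nsmul_le_sum univ _ _ fun z _ => (hb z).1
    rwa [nsmul_eq_mul, card_univ, hc, mul_comm (P : ℝ)] at this
  · have := sum_le_card_nsmul univ _ _ fun z _ => (hb z).2
    rwa [nsmul_eq_mul, card_univ, hc, mul_comm (P : ℝ)] at this

/-! ### The tail of the singular series -/

theorem inv_one_sub_inv_pow_le {p : ℕ} (hp : p.Prime) (k : ℕ) :
    0 < (1 - 1 / (p : ℝ)) ^ k ∧ ((1 - 1 / (p : ℝ)) ^ k)⁻¹ ≤ 2 ^ k := by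
  have hp2 : (2 : ℝ) ≤ p := by exact_mod_cast hp.two_le
  have ht : 1 / (p : ℝ) ≤ 1 / 2 := one_div_le_one_div_of_le two_pos hp2
  refine ⟨pow_pos (by linarith) _, ?_⟩
  rw [← inv_pow]
  refine pow_le_pow_left₀ (inv_nonneg.2 (by linarith)) ?_ _
  exact inv_le_of_inv_le₀ two_pos (by linarith)

theorem singularFactor_nonneg (D : Finset ℕ) {p : ℕ} (hp : p.Prime) : 0 ≤ singularFactor D p := by
  have hp0 : (0 : ℝ) < p := by exact_mod_cast hp.pos
  refine mul_nonneg (inv_nonneg.2 (inv_one_sub_inv_pow_le hp _).1.le) (sub_nonneg.2 ?_)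
  rw [div_le_one hp0]
  exact_mod_cast residueCount_le D hp.pos

theorem truncatedSeries_nonneg (y : ℕ) (D : Finset ℕ) : 0 ≤ truncatedSeries y D :=
  prod_nonneg fun _ hp => singularFactor_nonneg D (Nat.prime_of_mem_primesLE hp)

theorem singularFactor_sub_one (D : Finset ℕ) {p : ℕ} (hp : p.Prime) :
    singularFactor D p - 1 = ((1 - 1 / (p : ℝ)) ^ #D)⁻¹ *
      (1 - (residueCount D p : ℝ) / p - (1 - 1 / (p : ℝ)) ^ #D) := by
  have := (inv_one_sub_inv_pow_le hp #D).1.ne'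
  unfold singularFactor
  rw [mul_sub _ _ ((1 - 1 / (p : ℝ)) ^ #D), inv_mul_cancel₀ this]

/-- Both `1 - ν / p` and `(1 - 1 / p) ^ k` lie between `1 - k / p` and `1`. -/
theorem abs_singularFactor_sub_one_le (D : Finset ℕ) {p : ℕ} (hp : p.Prime) :
    |singularFactor D p - 1| ≤ 2 ^ #D * #D / p := by
  obtain ⟨h1, h2⟩ := inv_one_sub_inv_pow_le hp #D
  have hp0 : (1 : ℝ) ≤ p := by exact_mod_cast hp.one_le
  rw [singularFactor_sub_one D hp, abs_mul, abs_of_pos (inv_pos.2 h1), mul_div_assoc]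
  refine mul_le_mul h2 ?_ (abs_nonneg _) (by positivity)
  have ht0 : 0 ≤ 1 / (p : ℝ) := by positivity
  have ht1 : 1 / (p : ℝ) ≤ 1 := div_le_one_of_le₀ hp0 (by positivity)
  have h3 := (abs_linear_sub_pow_le #D (1 / p) ht0 ht1).1
  have h4 : (1 - 1 / (p : ℝ)) ^ #D ≤ 1 := pow_le_one₀ (by linarith) (by linarith)
  have h5 : (residueCount D p : ℝ) / p ≤ #D / p := by
    gcongr
    exact_mod_cast residueCount_le_card D p
  have h6 : 0 ≤ (residueCount D p : ℝ) / p := by positivity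
  have h7 : (#D : ℝ) * (1 / p) = #D / p := by ring
  rw [abs_le]
  constructor <;> linarith

/-- When `ν = k` the terms of order `1 / p` cancel, which makes the sum over such primes converge.
-/
theorem abs_singularFactor_sub_one_le_of_residueCount_eq {D : Finset ℕ} {p : ℕ} (hp : p.Prime)
    (hD : residueCount D p = #D) :
    |singularFactor D p - 1| ≤ 2 ^ #D * #D ^ 2 * ((p : ℝ) ^ 2)⁻¹ := by
  obtain ⟨h1, h2⟩ := inv_one_sub_inv_pow_le hp #D
  have hp0 : (1 : ℝ) ≤ p := by exact_mod_cast hp.one_le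
  rw [singularFactor_sub_one D hp, abs_mul, abs_of_pos (inv_pos.2 h1), mul_assoc, hD]
  refine mul_le_mul h2 ?_ (abs_nonneg _) (by positivity)
  have ht0 : 0 ≤ 1 / (p : ℝ) := by positivity
  have ht1 : 1 / (p : ℝ) ≤ 1 := div_le_one_of_le₀ hp0 (by positivity)
  have h3 := abs_linear_sub_pow_le #D (1 / p) ht0 ht1
  have h7 : (#D : ℝ) * (1 / p) = #D / p := by ring
  rw [h7, one_div, inv_pow] at h3
  rw [abs_sub_comm, one_div, abs_of_nonneg h3.1]
  exact h3.2

/-- The product of the differences of distinct elements of `D`, in absolute value. -/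
def differenceProduct (D : Finset ℕ) : ℕ :=
  ∏ q ∈ D.offDiag, ((q.1 : ℤ) - q.2).natAbs

theorem differenceProduct_ne_zero (D : Finset ℕ) : differenceProduct D ≠ 0 := by
  refine prod_ne_zero_iff.2 fun q hq => ?_
  rw [mem_offDiag] at hq
  omega

theorem differenceProduct_le {D : Finset ℕ} {h : ℕ} (hh : 0 < h) (hD : D ⊆ Icc 1 h) :
    differenceProduct D ≤ h ^ #D ^ 2 := by
  calc differenceProduct D ≤ h ^ #D.offDiag := by
        refine prod_le_pow_card _ _ _ fun q hq => ?_
        rw [mem_offDiag] at hq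
        have h1 := mem_Icc.1 (hD hq.1)
        have h2 := mem_Icc.1 (hD hq.2.1)
        omega
    _ ≤ h ^ #D ^ 2 := by
        refine Nat.pow_le_pow_right hh ?_
        rw [offDiag_card, sq]
        exact Nat.sub_le _ _

theorem dvd_differenceProduct {D : Finset ℕ} {p : ℕ} (h : residueCount D p ≠ #D) :
    p ∣ differenceProduct D := by
  have h1 : ¬ Set.InjOn (fun a => a % p) (D : Set ℕ) := fun hi => h (card_image_of_injOn hi)
  simp only [Set.InjOn, not_forall] at h1
  obtain ⟨a, ha, b, hb, hab, hne⟩ := h1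
  refine dvd_trans ?_ (dvd_prod_of_mem _ (mem_offDiag.2 ⟨ha, hb, hne⟩ : (a, b) ∈ D.offDiag))
  rw [← Int.natCast_dvd_natCast, Int.dvd_natAbs]
  exact (Nat.modEq_iff_dvd.1 (show b % p = a % p from hab.symm))

theorem sum_inv_sq_le_inv {y : ℕ} (hy : 0 < y) (t : Finset ℕ) (ht : ∀ p ∈ t, y < p) :
    ∑ p ∈ t, ((p : ℝ) ^ 2)⁻¹ ≤ (y : ℝ)⁻¹ := by
  set M := max y (t.sup id)
  calc ∑ p ∈ t, ((p : ℝ) ^ 2)⁻¹ ≤ ∑ p ∈ Ioc y M, ((p : ℝ) ^ 2)⁻¹ := by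
        refine sum_le_sum_of_subset_of_nonneg (fun p hp => ?_) fun _ _ _ => by positivity
        exact mem_Ioc.2 ⟨ht p hp, le_trans (le_sup (f := id) hp) (le_max_right _ _)⟩
    _ ≤ (y : ℝ)⁻¹ - (M : ℝ)⁻¹ := sum_Ioc_inv_sq_le_sub hy.ne' (le_max_left _ _)
    _ ≤ (y : ℝ)⁻¹ := by
        have : 0 ≤ (M : ℝ)⁻¹ := by positivity
        linarith

/-- A bound for `∑ p, |singularFactor D p - 1|` over the primes `p > y`, for `D ⊆ [1, h]` with
`k` elements. -/
noncomputable def tailBound (k y h : ℕ) : ℝ :=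
  2 ^ k * k ^ 2 * (y : ℝ)⁻¹ + 2 ^ k * k / y * (k ^ 2 * Real.log h / Real.log y)

/-- A prime modulo which two elements of `D` collide divides `differenceProduct D`. The product of
these primes is thus at most `h ^ k ^ 2`, while each of them exceeds `y`. -/
theorem card_filter_residueCount_ne_le {D : Finset ℕ} {y h : ℕ} (hy : 2 ≤ y) (hh : 0 < h)
    (hD : D ⊆ Icc 1 h) (t : Finset ℕ) (ht : ∀ p ∈ t, p.Prime ∧ y < p) :
    (#{p ∈ t | residueCount D p ≠ #D} : ℝ) ≤ #D ^ 2 * Real.log h / Real.log y := by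
  have hly : 0 < Real.log y := Real.log_pos (by exact_mod_cast hy)
  set b := {p ∈ t | residueCount D p ≠ #D} with hb
  have h1 : y ^ #b ≤ h ^ #D ^ 2 := by
    calc y ^ #b ≤ ∏ p ∈ b, p :=
          pow_card_le_prod _ _ _ fun p hp => (ht p (mem_filter.1 hp).1).2.le
      _ ≤ differenceProduct D := by
          refine Nat.le_of_dvd (Nat.pos_of_ne_zero (differenceProduct_ne_zero D)) ?_
          exact prod_primes_dvd _ (fun p hp => (ht p (mem_filter.1 hp).1).1.prime)
            fun p hp => dvd_differenceProduct (mem_filter.1 hp).2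
      _ ≤ _ := differenceProduct_le hh hD
  rw [le_div_iff₀ hly]
  have h2 : ((y : ℝ) ^ #b) ≤ (h : ℝ) ^ #D ^ 2 := by exact_mod_cast h1
  have h3 := Real.log_le_log (by positivity) h2
  rw [Real.log_pow, Real.log_pow] at h3
  exact_mod_cast h3

theorem sum_abs_singularFactor_sub_one_le {D : Finset ℕ} {y h : ℕ} (hy : 2 ≤ y) (hh : 0 < h)
    (hD : D ⊆ Icc 1 h) (t : Finset ℕ) (ht : ∀ p ∈ t, p.Prime ∧ y < p) :
    ∑ p ∈ t, |singularFactor D p - 1| ≤ tailBound #D y h := by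
  have hy0 : (0 : ℝ) < y := by positivity
  rw [← sum_filter_add_sum_filter_not t (fun p => residueCount D p = #D)]
  refine add_le_add ?_ ?_
  · calc _ ≤ ∑ p ∈ t with residueCount D p = #D, 2 ^ #D * #D ^ 2 * ((p : ℝ) ^ 2)⁻¹ :=
          sum_le_sum fun p hp => abs_singularFactor_sub_one_le_of_residueCount_eq
            (ht p (mem_filter.1 hp).1).1 (mem_filter.1 hp).2
      _ ≤ _ := by
          rw [← mul_sum]
          gcongr
          exact sum_inv_sq_le_inv (by omega) _ fun p hp => (ht p (mem_filter.1 hp).1).2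
  · calc _ ≤ ∑ p ∈ t with residueCount D p ≠ #D, 2 ^ #D * #D / (y : ℝ) := by
          refine sum_le_sum fun p hp => ?_
          have hp' := ht p (mem_filter.1 hp).1
          refine (abs_singularFactor_sub_one_le D hp'.1).trans ?_
          gcongr
          exact hp'.2.le
      _ ≤ _ := by
          rw [sum_const, nsmul_eq_mul, mul_comm]
          gcongr
          exact card_filter_residueCount_ne_le hy hh hD t ht

theorem abs_singularSeries_sub_truncatedSeries_le {D : Finset ℕ} {y h : ℕ} (hy : 2 ≤ y)
    (hh : 0 < h) (hD : D ⊆ Icc 1 h) :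
    |singularSeries D - truncatedSeries y D|
      ≤ (Real.exp (tailBound #D y h) - 1) * truncatedSeries y D := by
  have hlim : Tendsto (fun s : Finset Nat.Primes => ∏ p ∈ s, singularFactor D p) atTop
      (𝓝 (singularSeries D)) := (multipliable_singularFactor D).hasProd
  have hcl : IsClosed {r : ℝ | |r - truncatedSeries y D|
      ≤ (Real.exp (tailBound #D y h) - 1) * truncatedSeries y D} :=
    isClosed_le (by fun_prop) (by fun_prop)
  -- The estimate is a closed condition, so it suffices to check the finite partial products that
  -- contain all primes up to `y`.
  refine hcl.mem_of_tendsto hlim ?_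
  filter_upwards [eventually_ge_atTop ((Nat.primesLE y).subtype Nat.Prime)] with s hs
  set s' : Finset ℕ := s.map ⟨fun p : Nat.Primes => (p : ℕ), Subtype.val_injective⟩ with hs'
  have hprime : ∀ p ∈ s', p.Prime := by
    intro p hp
    obtain ⟨q, -, rfl⟩ := mem_map.1 hp
    exact q.2
  have hsub : Nat.primesLE y ⊆ s' := by
    intro p hp
    have hpp := Nat.prime_of_mem_primesLE hp
    exact mem_map.2 ⟨⟨p, hpp⟩, hs (mem_subtype.2 hp), rfl⟩
  have e1 : ∏ p ∈ s, singularFactor D p = ∏ p ∈ s', singularFactor D p := by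
    rw [hs', prod_map]; rfl
  have e2 : ∏ p ∈ s', singularFactor D p
      = (∏ p ∈ s' \ Nat.primesLE y, singularFactor D p) * truncatedSeries y D :=
    (prod_sdiff hsub).symm
  have h3 := norm_prod_one_add_sub_one_le (s' \ Nat.primesLE y) fun p => singularFactor D p - 1
  simp only [add_sub_cancel, Real.norm_eq_abs] at h3
  have h4 := sum_abs_singularFactor_sub_one_le hy hh hD (s' \ Nat.primesLE y) fun p hp => by
    rw [Finset.mem_sdiff, Nat.mem_primesLE] at hp
    have := hprime p hp.1
    exact ⟨this, by grind⟩
  have h5 := truncatedSeries_nonneg y D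
  change |∏ p ∈ s, singularFactor D p - truncatedSeries y D| ≤ _
  rw [e1, e2, ← sub_one_mul, abs_mul, abs_of_nonneg h5]
  refine mul_le_mul_of_nonneg_right (h3.trans ?_) h5
  exact sub_le_sub_right (Real.exp_le_exp.2 h4) _

/-! ### The singular series on average -/

/-- The height at which the singular series of subsets of `[1, h]` is truncated. -/
noncomputable def sieveLevel (h : ℕ) : ℕ := ⌊Real.log h / 8⌋₊

theorem tendsto_sieveLevel : Tendsto sieveLevel atTop atTop :=
  tendsto_nat_floor_atTop.comp
    ((Real.tendsto_log_atTop.comp tendsto_natCast_atTop_atTop).atTop_div_const (by norm_num))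

/-- The level must be large enough that `log h / (y * log y)` tends to `0`, where the numerator
counts colliding primes; `y` of order `log h` suffices. -/
theorem tendsto_tailBound (k : ℕ) :
    Tendsto (fun h => tailBound k (sieveLevel h) h) atTop (𝓝 0) := by
  have hy : Tendsto (fun h => (sieveLevel h : ℝ)) atTop atTop :=
    tendsto_natCast_atTop_atTop.comp tendsto_sieveLevel
  have h1 : Tendsto (fun h => ((sieveLevel h : ℝ))⁻¹) atTop (𝓝 0) := tendsto_inv_atTop_zero.comp hy
  have h2 : Tendsto (fun h => (Real.log (sieveLevel h : ℝ))⁻¹) atTop (𝓝 0) :=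
    tendsto_inv_atTop_zero.comp (Real.tendsto_log_atTop.comp hy)
  have hb : Tendsto (fun h => 2 ^ k * k ^ 2 * ((sieveLevel h : ℝ))⁻¹
      + 2 ^ k * k * k ^ 2 * 16 * (Real.log (sieveLevel h : ℝ))⁻¹) atTop (𝓝 0) := by
    simpa using (h1.const_mul (2 ^ k * (k : ℝ) ^ 2)).add
      (h2.const_mul (2 ^ k * (k : ℝ) * k ^ 2 * 16))
  refine tendsto_of_tendsto_of_tendsto_of_le_of_le' tendsto_const_nhds hb ?_ ?_
  · refine Eventually.of_forall fun h => ?_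
    have := Real.log_natCast_nonneg h
    have := Real.log_natCast_nonneg (sieveLevel h)
    simp only [tailBound]
    positivity
  · filter_upwards [hy.eventually_ge_atTop 2] with h hh
    -- `log h < 8 * (y + 1) ≤ 16 * y` once `y ≥ 1`.
    have hlog : Real.log h / (sieveLevel h : ℝ) ≤ 16 := by
      rw [div_le_iff₀ (by linarith)]
      have := Nat.lt_floor_add_one (Real.log h / 8)
      have e : ((⌊Real.log h / 8⌋₊ : ℕ) : ℝ) = sieveLevel h := rfl
      linarith
    have hl0 : 0 ≤ (Real.log (sieveLevel h : ℝ))⁻¹ :=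
      inv_nonneg.2 (Real.log_natCast_nonneg _)
    refine add_le_add le_rfl ?_
    calc _ = 2 ^ k * (k : ℝ) * k ^ 2 * (Real.log h / (sieveLevel h : ℝ))
          * (Real.log (sieveLevel h : ℝ))⁻¹ := by ring
      _ ≤ _ := by gcongr

/-- The relative error in counting the elements of an interval of length `h` that are coprime to
`primorial (sieveLevel h)`. -/
noncomputable def sieveError (k h : ℕ) : ℝ :=
  ((primorial (sieveLevel h) : ℝ) + k) /
    (h * (((primorial (sieveLevel h)).totient : ℝ) / primorial (sieveLevel h)))

/-- The level must also be small enough that the square of the primorial is a power of `h` below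
`1`; this is the role of the factor `1 / 8`. -/
theorem tendsto_sieveError (k : ℕ) : Tendsto (sieveError k) atTop (𝓝 0) := by
  have hb : Tendsto (fun h : ℕ => (1 + (k : ℝ)) * ((h : ℝ) ^ (-(5 / 8) : ℝ))) atTop (𝓝 0) := by
    have := (tendsto_rpow_neg_atTop (y := 5 / 8) (by norm_num)).comp
      (tendsto_natCast_atTop_atTop (R := ℝ))
    simpa using this.const_mul (1 + (k : ℝ))
  refine tendsto_of_tendsto_of_tendsto_of_le_of_le' tendsto_const_nhds hb ?_ ?_
  · exact Eventually.of_forall fun h => by simp only [sieveError]; positivity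
  · filter_upwards [eventually_ge_atTop 1] with h hh
    have hh0 : (0 : ℝ) < h := by exact_mod_cast hh
    have hP : 1 ≤ primorial (sieveLevel h) := primorial_pos (sieveLevel h)
    have hφ : (1 : ℝ) ≤ (primorial (sieveLevel h)).totient := by
      exact_mod_cast Nat.totient_pos.2 hP
    have h4 : (primorial (sieveLevel h) : ℝ) ≤ 4 ^ sieveLevel h := by
      exact_mod_cast primorial_le_four_pow _
    set P : ℝ := ((primorial (sieveLevel h) : ℕ) : ℝ) with hPdef
    have hP1 : (1 : ℝ) ≤ P := by rw [hPdef]; exact_mod_cast hP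
    -- `P ≤ 4 ^ y`, so `P ^ 2 ≤ 16 ^ y ≤ exp (3 * y)` with `y ≤ log h / 8`. Division by `h` leaves
    -- the exponent `-5 / 8`.
    have h5 : P * P ≤ (h : ℝ) ^ (3 / 8 : ℝ) := by
      have hl : (16 : ℝ) ≤ Real.exp 3 := by
        have := Real.exp_one_gt_d9
        have e : Real.exp 3 = Real.exp 1 ^ 3 := by rw [← Real.exp_nat_mul]; norm_num
        rw [e]
        calc (16 : ℝ) ≤ 2.7 ^ 3 := by norm_num
          _ ≤ _ := pow_le_pow_left₀ (by norm_num) (by linarith) _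
      calc P * P ≤ 4 ^ sieveLevel h * 4 ^ sieveLevel h := by gcongr
        _ = 16 ^ sieveLevel h := by rw [← mul_pow]; norm_num
        _ ≤ Real.exp 3 ^ sieveLevel h := by gcongr
        _ = Real.exp (sieveLevel h * 3) := by rw [← Real.exp_nat_mul]
        _ ≤ Real.exp (Real.log h * (3 / 8)) := by
            refine Real.exp_le_exp.2 ?_
            have : (sieveLevel h : ℝ) ≤ Real.log h / 8 :=
              Nat.floor_le (div_nonneg (Real.log_natCast_nonneg h) (by norm_num))
            linarith
        _ = _ := by rw [Real.rpow_def_of_pos hh0]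
    have e : (h : ℝ) ^ (-(5 / 8) : ℝ) = (h : ℝ) ^ (3 / 8 : ℝ) / h := by
      rw [← Real.rpow_sub_one hh0.ne']; norm_num
    rw [e, sieveError, ← hPdef]
    calc (P + k) / (h * ((primorial (sieveLevel h)).totient / P))
        ≤ (P + k) / (h * (1 / P)) := by gcongr
      _ = (P + k) * P / h := by field_simp
      _ ≤ ((1 + k) * P * P) / h := by
          gcongr
          have : (0 : ℝ) ≤ k := by positivity
          nlinarith
      _ ≤ (1 + k) * ((h : ℝ) ^ (3 / 8 : ℝ) / h) := by
          rw [mul_assoc, mul_div_assoc]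
          gcongr

theorem tendsto_sum_truncatedSeries (k : ℕ) :
    Tendsto (fun h : ℕ => (∑ D ∈ (Icc 1 h).powersetCard k, truncatedSeries (sieveLevel h) D)
      / (h : ℝ) ^ k) atTop (𝓝 (1 / k.factorial)) := by
  have hf : (k.factorial : ℝ) ≠ 0 := by exact_mod_cast k.factorial_ne_zero
  have hd := tendsto_sieveError k
  have hlow : Tendsto (fun h => (1 - sieveError k h) ^ k) atTop (𝓝 1) := by
    simpa using (hd.const_sub 1).pow k
  have hupp : Tendsto (fun h => (1 + sieveError k h) ^ k) atTop (𝓝 1) := by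
    simpa using (hd.const_add 1).pow k
  have hev : ∀ᶠ h : ℕ in atTop, 0 < h ∧ sieveError k h ≤ 1 :=
    (eventually_gt_atTop 0).and (hd.eventually_le_const one_pos)
  have key := tendsto_of_tendsto_of_tendsto_of_le_of_le' hlow hupp
    (hev.mono fun h hh => (sum_truncatedSeries_mem_Icc hh.1 hh.2).1)
    (hev.mono fun h hh => (sum_truncatedSeries_mem_Icc hh.1 hh.2).2)
  refine (key.div_const (k.factorial : ℝ)).congr fun h => ?_
  field_simp

/-- Gallagher's theorem: the singular series of the `k`-subsets of `[1, h]` is `1` on average. -/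
theorem tendsto_sum_singularSeries (k : ℕ) :
    Tendsto (fun h : ℕ => (∑ D ∈ (Icc 1 h).powersetCard k, singularSeries D) / (h : ℝ) ^ k)
      atTop (𝓝 (1 / k.factorial)) := by
  have hT := tendsto_sum_truncatedSeries k
  have hε : Tendsto (fun h => Real.exp (tailBound k (sieveLevel h) h) - 1) atTop (𝓝 0) := by
    have := ((Real.continuous_exp.tendsto 0).comp (tendsto_tailBound k)).sub_const 1
    simpa using this
  have h0 := hε.mul hT
  rw [zero_mul] at h0
  have hdiff : Tendsto (fun h : ℕ =>
      (∑ D ∈ (Icc 1 h).powersetCard k, singularSeries D) / (h : ℝ) ^ k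
      - (∑ D ∈ (Icc 1 h).powersetCard k, truncatedSeries (sieveLevel h) D) / (h : ℝ) ^ k)
      atTop (𝓝 0) := by
    refine squeeze_zero_norm' ?_ h0
    filter_upwards [eventually_gt_atTop 0, tendsto_sieveLevel.eventually_ge_atTop 2] with h hh hy
    rw [← sub_div, ← sum_sub_distrib, Real.norm_eq_abs, abs_div,
      abs_of_nonneg (show (0 : ℝ) ≤ (h : ℝ) ^ k by positivity), ← mul_div_assoc, mul_sum]
    refine div_le_div_of_nonneg_right ?_ (by positivity)
    refine (abs_sum_le_sum_abs _ _).trans (sum_le_sum fun D hD => ?_)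
    obtain ⟨hD1, rfl⟩ := mem_powersetCard.1 hD
    exact abs_singularSeries_sub_truncatedSeries_le hy hh hD1
  simpa using hdiff.add hT

/-! ### Binomial moments of the number of primes in short intervals -/

/-- The integer part of `μ log x`. -/
noncomputable def windowLength (μ x : ℝ) : ℕ := ⌊μ * Real.log x⌋₊

/-- The number of primes among `n + 1, …, n + h`. -/
def primesInWindow (h n : ℕ) : ℕ := #{a ∈ Icc 1 h | (n + a).Prime}

/-- The sum over `n ≤ x` of the number of `k`-subsets of the primes in `(n, n + μ log x]`. -/
noncomputable def binomialMoment (k : ℕ) (μ x : ℝ) : ℝ :=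
  ∑ n ∈ Icc 1 ⌊x⌋₊, ((primesInWindow (windowLength μ x) n).choose k : ℝ)

theorem windowLength_le {μ x : ℝ} (hμ : 0 ≤ μ) (hx : 1 ≤ x) :
    (windowLength μ x : ℝ) ≤ μ * Real.log x :=
  Nat.floor_le (mul_nonneg hμ (Real.log_nonneg hx))

theorem tendsto_windowLength {μ : ℝ} (hμ : 0 < μ) : Tendsto (windowLength μ) atTop atTop :=
  tendsto_nat_floor_atTop.comp (Real.tendsto_log_atTop.const_mul_atTop hμ)

theorem tendsto_windowLength_div_log {μ : ℝ} (hμ : 0 ≤ μ) :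
    Tendsto (fun x => (windowLength μ x : ℝ) / Real.log x) atTop (𝓝 μ) :=
  (tendsto_nat_floor_mul_div_atTop hμ).comp Real.tendsto_log_atTop

theorem tendsto_windowLength_pow_div {μ : ℝ} (hμ : 0 ≤ μ) (k : ℕ) :
    Tendsto (fun x => (windowLength μ x : ℝ) ^ k / x) atTop (𝓝 0) := by
  have h1 := ((tendsto_windowLength_div_log hμ).pow k).mul
    (Real.isLittleO_pow_log_id_atTop (n := k)).tendsto_div_nhds_zero
  rw [mul_zero] at h1
  refine h1.congr' ?_
  filter_upwards [eventually_gt_atTop 1] with x hx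
  have := (Real.log_pos hx).ne'
  rw [div_pow, id]
  field_simp

theorem binomialMoment_eq (k : ℕ) (μ x : ℝ) :
    binomialMoment k μ x
      = ∑ D ∈ (Icc 1 (windowLength μ x)).powersetCard k, (tupleCount x D : ℝ) := by
  unfold binomialMoment tupleCount primesInWindow
  rw [← Nat.cast_sum, ← Nat.cast_sum]
  congr 1
  simp_rw [← sum_powersetCard_ite, card_filter]
  exact sum_comm

theorem exists_residueCount_eq {D : Finset ℕ} (hD : ¬ Admissible D) :
    ∃ p : ℕ, p.Prime ∧ residueCount D p = p := by
  simp only [Admissible, not_forall, not_lt] at hD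
  obtain ⟨p, hp, h⟩ := hD
  exact ⟨p, hp, (residueCount_le D hp.pos).antisymm h⟩

theorem singularSeries_eq_zero {D : Finset ℕ} (hD : ¬ Admissible D) : singularSeries D = 0 := by
  obtain ⟨p, hp, h⟩ := exists_residueCount_eq hD
  have hp0 : (p : ℝ) ≠ 0 := by exact_mod_cast hp.ne_zero
  refine tprod_of_exists_eq_zero ⟨⟨p, hp⟩, ?_⟩
  change singularFactor D p = 0
  rw [singularFactor, h, div_self hp0, sub_self, mul_zero]

/-- If `D` covers all classes modulo `p`, every `n` has some `n + a` divisible by `p`. Primality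
forces `n + a = p`, hence `n ≤ p`, and `p` is at most `#D` because `D` occupies `p` classes. -/
theorem tupleCount_le_card {D : Finset ℕ} (hD : ¬ Admissible D) (x : ℝ) : tupleCount x D ≤ #D := by
  obtain ⟨p, hp, h⟩ := exists_residueCount_eq hD
  have himg : D.image (fun a => a % p) = range p := by
    refine eq_of_subset_of_card_le (fun r hr => ?_) (by rw [card_range]; exact h.ge)
    obtain ⟨a, -, rfl⟩ := mem_image.1 hr
    exact mem_range.2 (Nat.mod_lt _ hp.pos)
  calc tupleCount x D ≤ #(Icc 1 p) := by
        refine card_le_card fun n hn => ?_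
        obtain ⟨hn1, hn2⟩ := mem_filter.1 hn
        have hr : (p - n % p) % p ∈ D.image (fun a => a % p) := by
          rw [himg]; exact mem_range.2 (Nat.mod_lt _ hp.pos)
        obtain ⟨a, ha, hap⟩ := mem_image.1 hr
        have hdvd : p ∣ n + a := by
          have h1 : n + a ≡ n % p + (p - n % p) [MOD p] :=
            Nat.ModEq.add (Nat.mod_modEq n p).symm hap
          rw [Nat.add_sub_cancel' (Nat.mod_lt n hp.pos).le] at h1
          exact (Nat.modEq_zero_iff_dvd).1 (h1.trans (by simp [Nat.ModEq]))
        have := (Nat.prime_dvd_prime_iff_eq hp (hn2 a ha)).1 hdvd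
        exact mem_Icc.2 ⟨(mem_Icc.1 hn1).1, by omega⟩
    _ = p := by simp
    _ ≤ #D := by rw [← h]; exact residueCount_le_card D p

/-- The conjecture handles the admissible sets. The others have zero singular series and at most `k`
solutions each, and there are at most `h ^ k` of them, which is the second error term. -/
theorem abs_binomialMoment_sub_le (hHL : HardyLittlewoodConjecture) {k : ℕ} (hk : 2 ≤ k) {μ : ℝ}
    (hμ : 0 < μ) {ε : ℝ} (hε : 0 < ε) :
    ∀ᶠ x : ℝ in atTop, |binomialMoment k μ x
        - (∑ D ∈ (Icc 1 (windowLength μ x)).powersetCard k, singularSeries D)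
          * (x / Real.log x ^ k)|
      ≤ ε * ((∑ D ∈ (Icc 1 (windowLength μ x)).powersetCard k, singularSeries D)
          * (x / Real.log x ^ k)) + k * (windowLength μ x : ℝ) ^ k := by
  filter_upwards [hHL k hk μ hμ (fun x => μ * Real.log x) IsEquivalent.refl ε hε,
    eventually_ge_atTop 1] with x hx hx1
  have hterm : ∀ D ∈ (Icc 1 (windowLength μ x)).powersetCard k,
      |(tupleCount x D : ℝ) - singularSeries D * (x / Real.log x ^ k)|
        ≤ ε * (singularSeries D * (x / Real.log x ^ k)) + k := by
    intro D hD
    obtain ⟨hD1, hD2⟩ := mem_powersetCard.1 hD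
    by_cases hadm : Admissible D
    · refine (hx D hD2 hadm fun a ha => ?_).trans (by linarith [Nat.cast_nonneg (α := ℝ) k])
      have ha' := mem_Icc.1 (hD1 ha)
      exact ⟨ha'.1, (Nat.le_floor_iff' (by omega)).1 ha'.2⟩
    · rw [singularSeries_eq_zero hadm, zero_mul, sub_zero, mul_zero, zero_add, abs_of_nonneg
        (Nat.cast_nonneg _), ← hD2]
      exact_mod_cast tupleCount_le_card hadm x
  rw [binomialMoment_eq, sum_mul, ← sum_sub_distrib]
  refine (abs_sum_le_sum_abs _ _).trans ((sum_le_sum hterm).trans ?_)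
  rw [sum_add_distrib, ← mul_sum, sum_const, card_powersetCard, Nat.card_Icc, Nat.add_sub_cancel,
    nsmul_eq_mul, mul_comm _ (k : ℝ)]
  gcongr
  exact_mod_cast Nat.choose_le_pow _ _

theorem tendsto_binomialMoment_of_two_le (hHL : HardyLittlewoodConjecture) {k : ℕ} (hk : 2 ≤ k)
    {μ : ℝ} (hμ : 0 < μ) :
    Tendsto (fun x => binomialMoment k μ x / x) atTop (𝓝 (μ ^ k / k.factorial)) := by
  set c : ℝ → ℝ := fun x =>
    (∑ D ∈ (Icc 1 (windowLength μ x)).powersetCard k, singularSeries D) / Real.log x ^ k with hc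
  have hclim : Tendsto c atTop (𝓝 (μ ^ k / k.factorial)) := by
    have h1 := ((tendsto_sum_singularSeries k).comp (tendsto_windowLength hμ)).mul
      ((tendsto_windowLength_div_log hμ.le).pow k)
    rw [one_div_mul_eq_div] at h1
    refine h1.congr' ?_
    filter_upwards [(tendsto_windowLength hμ).eventually_gt_atTop 0] with x hx
    have : (windowLength μ x : ℝ) ≠ 0 := by exact_mod_cast hx.ne'
    simp only [hc, Function.comp]
    rw [div_pow]
    field_simp
  have hr : Tendsto (fun x => k * ((windowLength μ x : ℝ) ^ k / x)) atTop (𝓝 0) := by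
    simpa using (tendsto_windowLength_pow_div hμ.le k).const_mul (k : ℝ)
  have hdiff : Tendsto (fun x => binomialMoment k μ x / x - c x) atTop (𝓝 0) := by
    rw [Metric.tendsto_nhds]
    intro δ hδ
    set C := μ ^ k / k.factorial + 1 with hC
    have hC0 : 0 < C := by positivity
    have hε : 0 < δ / (2 * C) := by positivity
    filter_upwards [abs_binomialMoment_sub_le hHL hk hμ hε, eventually_gt_atTop 0,
      hclim.eventually_lt_const (show μ ^ k / k.factorial < C by linarith),
      hr.eventually_lt_const (half_pos hδ)] with x h1 h2 h3 h4
    rw [Real.dist_eq, sub_zero]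
    have e1 : (∑ D ∈ (Icc 1 (windowLength μ x)).powersetCard k, singularSeries D)
        * (x / Real.log x ^ k) = c x * x := by simp only [hc]; ring
    rw [e1] at h1
    have e2 : binomialMoment k μ x / x - c x = (binomialMoment k μ x - c x * x) / x := by
      field_simp
    rw [e2, abs_div, abs_of_pos h2]
    calc _ ≤ (δ / (2 * C) * (c x * x) + k * (windowLength μ x : ℝ) ^ k) / x := by gcongr
      _ = δ / (2 * C) * c x + k * ((windowLength μ x : ℝ) ^ k / x) := by field_simp
      _ < δ / (2 * C) * C + δ / 2 := by gcongr
      _ = δ := by field_simp; ring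
  simpa using hdiff.add hclim

/-! ### The prime number theorem from the moments of order two and three -/

theorem abs_card_shift_prime_sub_le (N a : ℕ) :
    |(#{n ∈ Icc 1 N | (n + a).Prime} : ℝ) - N.primeCounting| ≤ a := by
  have e : N.primeCounting = #{p ∈ Icc 1 N | p.Prime} := by
    rw [← Nat.primesLE_card_eq_primeCounting, Nat.primesLE_eq_filter_Icc_one]
  set S : Finset ℕ := {n ∈ Icc 1 N | (n + a).Prime}
  set T : Finset ℕ := {p ∈ Icc 1 N | p.Prime}
  have h1 : #S ≤ #T + a := by
    calc #S = #(S.image (· + a)) := (card_image_of_injective _ (add_left_injective a)).symm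
      _ ≤ #(T ∪ Ioc N (N + a)) := card_le_card fun q hq => by
          simp only [S, T, mem_image, mem_filter, mem_union, mem_Icc, mem_Ioc] at hq ⊢
          obtain ⟨n, hn, rfl⟩ := hq
          by_cases h : n + a ≤ N
          · exact Or.inl ⟨by omega, hn.2⟩
          · exact Or.inr (by omega)
      _ ≤ #T + #(Ioc N (N + a)) := card_union_le _ _
      _ = #T + a := by simp
  have h2 : #T ≤ #S + a := by
    calc #T ≤ #(S.image (· + a) ∪ Icc 1 a) := card_le_card fun q hq => by
          simp only [S, T, mem_image, mem_filter, mem_union, mem_Icc] at hq ⊢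
          by_cases h : q ≤ a
          · exact Or.inr (by omega)
          · refine Or.inl ⟨q - a, ⟨by omega, ?_⟩, by omega⟩
            rw [show q - a + a = q by omega]
            exact hq.2
      _ ≤ #(S.image (· + a)) + #(Icc 1 a) := card_union_le _ _
      _ = #S + a := by rw [card_image_of_injective _ (add_left_injective a)]; simp
  have h1' : (#S : ℝ) ≤ #T + a := by exact_mod_cast h1
  have h2' : (#T : ℝ) ≤ #S + a := by exact_mod_cast h2
  rw [e, abs_le]
  constructor <;> linarith

/-- Summing over the position `a` in the window first, each shifted prime count differs from `π(x)`
by at most `a`. -/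
theorem abs_binomialMoment_one_sub_le (μ x : ℝ) :
    |binomialMoment 1 μ x - windowLength μ x * (⌊x⌋₊.primeCounting : ℝ)|
      ≤ (windowLength μ x : ℝ) ^ 2 := by
  have e : binomialMoment 1 μ x
      = ∑ a ∈ Icc 1 (windowLength μ x), (#{n ∈ Icc 1 ⌊x⌋₊ | (n + a).Prime} : ℝ) := by
    unfold binomialMoment primesInWindow
    simp only [Nat.choose_one_right]
    rw [← Nat.cast_sum, ← Nat.cast_sum]
    congr 1
    simp only [card_filter]
    exact sum_comm
  have e2 : windowLength μ x * (⌊x⌋₊.primeCounting : ℝ)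
      = ∑ _a ∈ Icc 1 (windowLength μ x), (⌊x⌋₊.primeCounting : ℝ) := by simp
  rw [e, e2, ← sum_sub_distrib]
  refine (abs_sum_le_sum_abs _ _).trans ?_
  calc _ ≤ ∑ _a ∈ Icc 1 (windowLength μ x), (windowLength μ x : ℝ) := by
        refine sum_le_sum fun a ha => (abs_card_shift_prime_sub_le _ a).trans ?_
        exact_mod_cast (mem_Icc.1 ha).2
    _ = _ := by simp [sq]

theorem cast_choose_three_mul (n : ℕ) :
    6 * (n.choose 3 : ℝ) = n * (n - 1) * (n - 2) := by
  have h := Nat.choose_succ_right_eq n 2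
  have h2 := Nat.cast_choose_two ℝ n
  rcases Nat.lt_or_ge n 2 with hn | hn
  · interval_cases n <;> simp [Nat.choose]
  · have h' : (n.choose 3 : ℝ) * 3 = n.choose 2 * (n - 2) := by
      rw [← Nat.cast_two (R := ℝ), ← Nat.cast_sub hn]
      exact_mod_cast h
    rw [h2] at h'
    linarith

/-- Cauchy–Schwarz together with `X ^ 2 = 2 * X.choose 2 + X`. -/
theorem sq_binomialMoment_one_le (μ x : ℝ) :
    binomialMoment 1 μ x ^ 2
      ≤ ⌊x⌋₊ * (2 * binomialMoment 2 μ x + binomialMoment 1 μ x) := by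
  unfold binomialMoment
  have h := sq_sum_le_card_mul_sum_sq (s := Icc 1 ⌊x⌋₊)
    (f := fun n => ((primesInWindow (windowLength μ x) n).choose 1 : ℝ))
  rw [Nat.card_Icc, Nat.add_sub_cancel] at h
  refine h.trans_eq ?_
  rw [mul_sum (Icc 1 ⌊x⌋₊) _ (2 : ℝ), ← sum_add_distrib]
  congr 1
  refine sum_congr rfl fun n _ => ?_
  rw [Nat.cast_choose_two, Nat.choose_one_right]
  ring

/-- Cauchy–Schwarz for `X * (X - 1) = √X * (√X * (X - 1))`, with `X * (X - 1) ^ 2 = 6 * X.choose 3 +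
2 * X.choose 2`. It bounds the first moment from below. -/
theorem sq_binomialMoment_two_le (μ x : ℝ) :
    4 * binomialMoment 2 μ x ^ 2
      ≤ binomialMoment 1 μ x * (6 * binomialMoment 3 μ x + 2 * binomialMoment 2 μ x) := by
  unfold binomialMoment
  have e : ∀ S : ℝ, 4 * S ^ 2 = (2 * S) ^ 2 := fun S => by ring
  rw [e, mul_sum, mul_sum (Icc 1 ⌊x⌋₊) _ (6 : ℝ), ← sum_add_distrib]
  refine sum_sq_le_sum_mul_sum_of_sq_le_mul _ (fun _ _ => by positivity)
    (fun _ _ => by positivity) fun n _ => le_of_eq ?_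
  rw [cast_choose_three_mul, Nat.cast_choose_two, Nat.choose_one_right]
  ring

theorem eventually_binomialMoment_one_le (hHL : HardyLittlewoodConjecture) {μ : ℝ} (hμ : 0 < μ) :
    ∀ᶠ x in atTop, binomialMoment 1 μ x / x ≤ 1 + μ := by
  have h2 := tendsto_binomialMoment_of_two_le hHL le_rfl hμ
  rw [show μ ^ 2 / (Nat.factorial 2 : ℝ) = μ ^ 2 / 2 by norm_num] at h2
  -- The slack is chosen so that the limiting inequality `m ^ 2 - m ≤ μ ^ 2 + μ` has `1 + μ` as its
  -- positive root.
  filter_upwards [h2.eventually_lt_const (show μ ^ 2 / 2 < (μ ^ 2 + μ) / 2 by linarith),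
    eventually_gt_atTop 0] with x hx hx0
  have h := sq_binomialMoment_one_le μ x
  have hm0 : 0 ≤ binomialMoment 1 μ x / x :=
    div_nonneg (sum_nonneg fun _ _ => by positivity) hx0.le
  have hA0 : 0 ≤ binomialMoment 2 μ x := sum_nonneg fun _ _ => by positivity
  have hB0 : 0 ≤ binomialMoment 1 μ x := sum_nonneg fun _ _ => by positivity
  have h3 : (binomialMoment 1 μ x / x) ^ 2
      ≤ 2 * (binomialMoment 2 μ x / x) + binomialMoment 1 μ x / x := by
    have h4 : binomialMoment 1 μ x ^ 2 ≤ x * (2 * binomialMoment 2 μ x + binomialMoment 1 μ x) :=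
      h.trans (mul_le_mul_of_nonneg_right (Nat.floor_le hx0.le) (by positivity))
    rw [div_pow, div_le_iff₀ (by positivity)]
    refine h4.trans_eq ?_
    field_simp
  by_contra! hcon
  nlinarith

theorem eventually_le_binomialMoment_one (hHL : HardyLittlewoodConjecture) {μ : ℝ} (hμ : 0 < μ) :
    ∀ᶠ x in atTop, μ - 1 ≤ binomialMoment 1 μ x / x := by
  have h2 := tendsto_binomialMoment_of_two_le hHL le_rfl hμ
  have h3 := tendsto_binomialMoment_of_two_le hHL (show 2 ≤ 3 by norm_num) hμ
  have hlim := ((h2.pow 2).const_mul 4).div ((h3.const_mul 6).add (h2.const_mul 2))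
    (by positivity)
  -- The right-hand side simplifies to `μ ^ 2 / (μ + 1)`.
  have hlt : μ - 1 < 4 * (μ ^ 2 / (Nat.factorial 2 : ℝ)) ^ 2
      / (6 * (μ ^ 3 / (Nat.factorial 3 : ℝ)) + 2 * (μ ^ 2 / (Nat.factorial 2 : ℝ))) := by
    have e2 : (Nat.factorial 2 : ℝ) = 2 := by norm_num [Nat.factorial]
    have e3 : (Nat.factorial 3 : ℝ) = 6 := by norm_num [Nat.factorial]
    rw [e2, e3, lt_div_iff₀ (by positivity)]
    nlinarith [pow_pos hμ 2, pow_pos hμ 3]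
  filter_upwards [hlim.eventually_const_lt hlt, eventually_gt_atTop 0] with x hx hx0
  refine hx.le.trans ?_
  simp only [Pi.div_apply]
  have h := sq_binomialMoment_two_le μ x
  have hB0 : 0 ≤ binomialMoment 1 μ x := sum_nonneg fun _ _ => by positivity
  have hA0 : 0 ≤ binomialMoment 2 μ x := sum_nonneg fun _ _ => by positivity
  have hC0 : 0 ≤ binomialMoment 3 μ x := sum_nonneg fun _ _ => by positivity
  refine div_le_of_le_mul₀ (by positivity) (by positivity) ?_
  have e : binomialMoment 1 μ x / x * (6 * (binomialMoment 3 μ x / x)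
      + 2 * (binomialMoment 2 μ x / x)) = (binomialMoment 1 μ x
        * (6 * binomialMoment 3 μ x + 2 * binomialMoment 2 μ x)) / x ^ 2 := by
    field_simp
  rw [e, div_pow, ← mul_div_assoc]
  gcongr

theorem tendsto_binomialMoment_one_sub (μ : ℝ) (hμ : 0 ≤ μ) :
    Tendsto (fun x => binomialMoment 1 μ x / x
      - windowLength μ x / Real.log x * (⌊x⌋₊.primeCounting * Real.log x / x)) atTop (𝓝 0) := by
  refine squeeze_zero_norm' ?_ (tendsto_windowLength_pow_div hμ 2)
  filter_upwards [eventually_gt_atTop 1] with x hx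
  have hx0 : 0 < x := by linarith
  have hl := (Real.log_pos hx).ne'
  have e : binomialMoment 1 μ x / x
      - windowLength μ x / Real.log x * (⌊x⌋₊.primeCounting * Real.log x / x)
      = (binomialMoment 1 μ x - windowLength μ x * ⌊x⌋₊.primeCounting) / x := by
    field_simp
  rw [e, Real.norm_eq_abs, abs_div, abs_of_pos hx0]
  gcongr
  exact abs_binomialMoment_one_sub_le μ x

/-- The prime number theorem follows from the `k`-tuples conjecture for `k = 2` and `k = 3`. -/
theorem tendsto_primeCounting_mul_log_div (hHL : HardyLittlewoodConjecture) :
    Tendsto (fun x : ℝ => ⌊x⌋₊.primeCounting * Real.log x / x) atTop (𝓝 1) := by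
  rw [Metric.tendsto_nhds]
  intro ε hε
  -- The estimates below give `1 - 2 / μ ≤ ρ ≤ 1 + 3 / (μ - 1)`, and this `μ` puts both ends within
  -- `ε` of `1`.
  set μ : ℝ := 2 + 4 / ε with hμdef
  have hμ : 2 < μ := by have : 0 < 4 / ε := by positivity
                        linarith
  have hμε : 3 < ε * (μ - 1) := by
    have : ε * (μ - 1) = ε + 4 := by rw [hμdef]; field_simp; ring
    linarith
  have hμ0 : 0 < μ := by linarith
  filter_upwards [eventually_binomialMoment_one_le hHL hμ0,
    eventually_le_binomialMoment_one hHL hμ0,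
    (tendsto_binomialMoment_one_sub μ hμ0.le).eventually_lt_const one_pos,
    (tendsto_binomialMoment_one_sub μ hμ0.le).eventually_const_lt (neg_one_lt_zero),
    (tendsto_windowLength_div_log hμ0.le).eventually_const_lt (sub_one_lt μ),
    eventually_gt_atTop 1] with x h1 h2 h3 h4 h5 hx
  have hl := Real.log_pos hx
  have h6 : windowLength μ x / Real.log x ≤ μ := by
    rw [div_le_iff₀ hl]; exact windowLength_le hμ0.le hx.le
  set ρ : ℝ := ⌊x⌋₊.primeCounting * Real.log x / x with hρ
  have hρ0 : 0 ≤ ρ := by positivity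
  set w : ℝ := windowLength μ x / Real.log x
  have h7 : (μ - 1) * ρ ≤ μ + 2 := by nlinarith
  have h8 : μ - 2 ≤ μ * ρ := by nlinarith
  rw [Real.dist_eq, abs_lt]
  constructor
  · nlinarith
  · nlinarith

theorem tendsto_binomialMoment (hHL : HardyLittlewoodConjecture) (k : ℕ) {μ : ℝ} (hμ : 0 < μ) :
    Tendsto (fun x => binomialMoment k μ x / x) atTop (𝓝 (μ ^ k / k.factorial)) := by
  match k with
  | 0 => simpa [binomialMoment] using tendsto_nat_floor_div_atTop (R := ℝ)
  | 1 =>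
    have h := (tendsto_binomialMoment_one_sub μ hμ.le).add
      ((tendsto_windowLength_div_log hμ.le).mul (tendsto_primeCounting_mul_log_div hHL))
    simpa using h
  | k + 2 => exact tendsto_binomialMoment_of_two_le hHL (by omega) hμ

/-! ### Intervals without primes -/

/-- The number of `n ≤ x` such that there are no primes in `(n, n + μ log x]`. -/
noncomputable def emptyWindowCount (μ x : ℝ) : ℕ :=
  #{n ∈ Icc 1 ⌊x⌋₊ | primesInWindow (windowLength μ x) n = 0}

/-- For `X > 0` the truncated sum has the sign of `(-1) ^ m` or vanishes, which gives Bonferroni's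
upper bound for even `m` and lower bound for odd `m`. -/
theorem alternating_sum_choose_eq (X m : ℕ) :
    ∑ k ∈ range (m + 1), (-1 : ℝ) ^ k * (X.choose k)
      = if X = 0 then 1 else (-1) ^ m * ((X - 1).choose m : ℝ) := by
  cases X with
  | zero =>
    rw [sum_range_succ']
    simp
  | succ X =>
    have h := congrArg (fun z : ℤ => (z : ℝ))
      (Int.alternating_sum_range_choose_eq_choose (n := X) (m := m))
    push_cast at h
    simpa using h

theorem emptyWindowCount_le (μ x : ℝ) (K : ℕ) :
    (emptyWindowCount μ x : ℝ)
      ≤ ∑ k ∈ range (2 * K + 1), (-1 : ℝ) ^ k * binomialMoment k μ x := by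
  unfold emptyWindowCount binomialMoment
  simp_rw [mul_sum]
  rw [sum_comm, card_filter, Nat.cast_sum]
  refine sum_le_sum fun n _ => ?_
  rw [alternating_sum_choose_eq, pow_mul, neg_one_sq, one_pow]
  split_ifs <;> simp

theorem le_emptyWindowCount (μ x : ℝ) (K : ℕ) :
    ∑ k ∈ range (2 * K + 1 + 1), (-1 : ℝ) ^ k * binomialMoment k μ x
      ≤ emptyWindowCount μ x := by
  unfold emptyWindowCount binomialMoment
  simp_rw [mul_sum]
  rw [sum_comm, card_filter, Nat.cast_sum]
  refine sum_le_sum fun n _ => ?_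
  rw [alternating_sum_choose_eq, pow_succ, pow_mul, neg_one_sq, one_pow]
  split_ifs <;> simp

/-- The truncation order is fixed while `x → ∞`, and only then increased, so no uniformity in `k` is
needed. -/
theorem tendsto_emptyWindowCount (hHL : HardyLittlewoodConjecture) {μ : ℝ} (hμ : 0 < μ) :
    Tendsto (fun x => (emptyWindowCount μ x : ℝ) / x) atTop (𝓝 (Real.exp (-μ))) := by
  have hs : Tendsto (fun m => ∑ k ∈ range m, (-1 : ℝ) ^ k * (μ ^ k / k.factorial)) atTop
      (𝓝 (Real.exp (-μ))) := by
    rw [Real.exp_eq_exp_ℝ]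
    refine ((NormedSpace.expSeries_div_hasSum_exp (-μ)).tendsto_sum_nat).congr fun m => ?_
    refine sum_congr rfl fun k _ => ?_
    rw [neg_pow, mul_div_assoc]
  have hM : ∀ m, Tendsto (fun x => (∑ k ∈ range m, (-1 : ℝ) ^ k * binomialMoment k μ x) / x) atTop
      (𝓝 (∑ k ∈ range m, (-1 : ℝ) ^ k * (μ ^ k / k.factorial))) := by
    intro m
    refine (tendsto_finsetSum (range m) fun k _ =>
      (tendsto_binomialMoment hHL k hμ).const_mul ((-1 : ℝ) ^ k)).congr fun x => ?_
    rw [sum_div]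
    exact sum_congr rfl fun k _ => (mul_div_assoc _ _ _).symm
  refine tendsto_order.2 ⟨fun a ha => ?_, fun a ha => ?_⟩
  · have h2 : Tendsto (fun K => 2 * K + 1 + 1) atTop atTop :=
      tendsto_atTop_mono (fun K => by simp only [id]; omega) tendsto_id
    obtain ⟨K, hK⟩ := ((hs.comp h2).eventually_const_lt ha).exists
    filter_upwards [(hM _).eventually_const_lt hK, eventually_gt_atTop 0] with x hx hx0
    refine hx.trans_le ?_
    gcongr
    exact le_emptyWindowCount μ x K
  · have h2 : Tendsto (fun K => 2 * K + 1) atTop atTop :=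
      tendsto_atTop_mono (fun K => by simp only [id]; omega) tendsto_id
    obtain ⟨K, hK⟩ := ((hs.comp h2).eventually_lt_const ha).exists
    filter_upwards [(hM _).eventually_lt_const hK, eventually_gt_atTop 0] with x hx hx0
    refine lt_of_le_of_lt ?_ hx
    gcongr
    exact emptyWindowCount_le μ x K

/-! ### Gaps and intervals without primes -/

theorem prime_prime (m : ℕ) : (prime m).Prime := Nat.prime_nth_prime m

theorem prime_lt_prime_succ (m : ℕ) : prime m < prime (m + 1) :=
  (Nat.nth_lt_nth Nat.infinite_setOfPred_prime).2 (Nat.lt_succ_self m)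

theorem prime_zero : prime 0 = 2 := Nat.nth_prime_zero_eq_two

theorem two_le_prime (m : ℕ) : 2 ≤ prime m := (prime_prime m).two_le

/-- Indices start at `0`, so the gaps with both ends up to `N` are those with index in `range
(N.primeCounting - 1)`. -/
theorem prime_le_iff {m N : ℕ} : prime m ≤ N ↔ m < N.primeCounting := by
  rw [← Nat.lt_succ_iff, Nat.primeCounting, Nat.primeCounting', ← not_le, ← not_le (b := m),
    Nat.count_le_iff_le_nth Nat.infinite_setOfPred_prime]
  rfl

theorem le_prime_of_lt_prime_succ {m q : ℕ} (hq : q.Prime) (h : q < prime (m + 1)) :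
    q ≤ prime m :=
  Nat.le_nth_of_lt_nth_succ h hq

theorem primesInWindow_eq_zero_iff {h n : ℕ} :
    primesInWindow h n = 0 ↔ ∀ a, 1 ≤ a → a ≤ h → ¬ (n + a).Prime := by
  simp [primesInWindow, filter_eq_empty_iff]

theorem primesInWindow_eq_zero_iff_of_mem_Ico {m h n : ℕ} (h1 : prime m ≤ n)
    (h2 : n < prime (m + 1)) : primesInWindow h n = 0 ↔ n + h < prime (m + 1) := by
  rw [primesInWindow_eq_zero_iff]
  constructor
  · intro hn
    by_contra! hcon
    refine hn (prime (m + 1) - n) (by omega) (by omega) ?_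
    rw [Nat.add_sub_cancel' h2.le]
    exact prime_prime _
  · intro hn a ha1 ha2 hp
    have := le_prime_of_lt_prime_succ hp (by omega : n + a < prime (m + 1))
    omega

/-- A window starting in the gap is empty exactly when it ends before the next prime. The truncated
subtraction yields `0` for gaps of length at most `h`. -/
theorem card_emptyWindow_gap (m h : ℕ) :
    #{n ∈ Ico (prime m) (prime (m + 1)) | primesInWindow h n = 0}
      = prime (m + 1) - prime m - h := by
  have e : {n ∈ Ico (prime m) (prime (m + 1)) | primesInWindow h n = 0}
      = Ico (prime m) (prime (m + 1) - h) := by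
    ext n
    simp only [mem_filter, mem_Ico]
    constructor
    · rintro ⟨⟨h1, h2⟩, h3⟩
      have := (primesInWindow_eq_zero_iff_of_mem_Ico h1 h2).1 h3
      omega
    · rintro ⟨h1, h2⟩
      have h3 : n < prime (m + 1) := by omega
      exact ⟨⟨h1, h3⟩, (primesInWindow_eq_zero_iff_of_mem_Ico h1 h3).2 (by omega)⟩
  rw [e, Nat.card_Ico]
  omega

/-- The sum of the excesses over `h` of the gaps between consecutive primes up to `N`. -/
noncomputable def gapExcess (N h : ℕ) : ℕ :=
  ∑ m ∈ range (N.primeCounting - 1), (prime (m + 1) - prime m - h)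

/-- The number of gaps exceeding `h` between consecutive primes up to `N`. -/
noncomputable def longGapCount (N h : ℕ) : ℕ :=
  #{m ∈ range (N.primeCounting - 1) | h < prime (m + 1) - prime m}

theorem sum_gap_sub_eq (M h : ℕ) :
    ∑ m ∈ range M, (prime (m + 1) - prime m - h)
      = #{n ∈ Ico 2 (prime M) | primesInWindow h n = 0} := by
  induction M with
  | zero => simp [prime_zero]
  | succ M ih =>
    rw [sum_range_succ, ih, ← card_emptyWindow_gap, ← card_union_of_disjoint, ← filter_union,
      Ico_union_Ico_eq_Ico (two_le_prime M) (prime_lt_prime_succ M).le]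
    exact disjoint_filter_filter (Ico_disjoint_Ico_consecutive _ _ _)

/-- The largest prime up to `N`. -/
noncomputable def lastPrime (N : ℕ) : ℕ := prime (N.primeCounting - 1)

theorem lastPrime_le {N : ℕ} (hN : 2 ≤ N) : lastPrime N ≤ N := by
  have : 0 < N.primeCounting := prime_le_iff.1 (by rw [prime_zero]; exact hN)
  exact prime_le_iff.2 (by omega)

theorem le_lastPrime {N q : ℕ} (hq : q.Prime) (h : q ≤ N) : q ≤ lastPrime N := by
  refine le_prime_of_lt_prime_succ hq (h.trans_lt ?_)
  by_contra! hcon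
  have := prime_le_iff.1 hcon
  omega

theorem gapExcess_le {N : ℕ} (hN : 2 ≤ N) (h : ℕ) :
    gapExcess N h ≤ #{n ∈ Icc 1 N | primesInWindow h n = 0} := by
  rw [gapExcess, sum_gap_sub_eq]
  refine card_le_card (filter_subset_filter _ fun n hn => ?_)
  have h1 : prime (N.primeCounting - 1) ≤ N := lastPrime_le hN
  rw [mem_Ico] at hn
  exact mem_Icc.2 ⟨by omega, by omega⟩

theorem card_emptyWindow_le {N : ℕ} (hN : 2 ≤ N) (h : ℕ) :
    #{n ∈ Icc 1 N | primesInWindow h n = 0} ≤ gapExcess N h + (N - lastPrime N + 2) := by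
  have h1 := lastPrime_le hN
  rw [gapExcess, sum_gap_sub_eq]
  calc _ ≤ #({n ∈ Ico 2 (lastPrime N) | primesInWindow h n = 0} ∪
        ({1} ∪ Icc (lastPrime N) N)) := card_le_card fun n hn => by
          simp only [mem_filter, mem_union, mem_Icc, mem_Ico, mem_singleton] at hn ⊢
          by_cases h2 : n = 1
          · exact Or.inr (Or.inl h2)
          · by_cases h3 : n < lastPrime N
            · exact Or.inl ⟨⟨by omega, h3⟩, hn.2⟩
            · exact Or.inr (Or.inr ⟨by omega, by omega⟩)
    _ ≤ _ := card_union_le _ _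
    _ ≤ _ := by
      gcongr
      · exact le_rfl
      · refine (card_union_le _ _).trans ?_
        rw [card_singleton, Nat.card_Icc]
        omega

/-- Every window that starts at or after the last prime and ends by `N` is empty, so a long stretch
without primes at the end would produce many empty windows. -/
theorem sub_lastPrime_le {N : ℕ} (h : ℕ) :
    N - lastPrime N ≤ #{n ∈ Icc 1 N | primesInWindow h n = 0} + h := by
  have h1 : #(Ico (lastPrime N) (N - h)) ≤ #{n ∈ Icc 1 N | primesInWindow h n = 0} := by
    refine card_le_card fun n hn => ?_
    rw [mem_Ico] at hn
    have h2 : 2 ≤ lastPrime N := two_le_prime _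
    rw [mem_filter, mem_Icc, primesInWindow_eq_zero_iff]
    refine ⟨⟨by omega, by omega⟩, fun a ha1 ha2 hp => ?_⟩
    have := le_lastPrime hp (show n + a ≤ N by omega)
    omega
  rw [Nat.card_Ico] at h1
  omega

/-- Raising the threshold from `h` to `h'` lowers the excess of a gap by at most `h' - h`, and only
if the gap exceeds `h`. Conversely, gaps exceeding `h'` lose exactly `h' - h`, whence
`add_le_gapExcess`. -/
theorem gapExcess_le_add (N : ℕ) {h h' : ℕ} (hh : h ≤ h') :
    gapExcess N h ≤ gapExcess N h' + (h' - h) * longGapCount N h := by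
  rw [gapExcess, gapExcess, longGapCount, card_filter, mul_sum, ← sum_add_distrib]
  refine sum_le_sum fun m _ => ?_
  split_ifs <;> omega

theorem add_le_gapExcess (N : ℕ) {h h' : ℕ} (hh : h ≤ h') :
    gapExcess N h' + (h' - h) * longGapCount N h' ≤ gapExcess N h := by
  rw [gapExcess, gapExcess, longGapCount, card_filter, mul_sum, ← sum_add_distrib]
  refine sum_le_sum fun m _ => ?_
  split_ifs <;> omega

theorem sum_longGap_eq (N h : ℕ) :
    ∑ m ∈ range (N.primeCounting - 1) with h < prime (m + 1) - prime m, (prime (m + 1) - prime m)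
      = gapExcess N h + h * longGapCount N h := by
  rw [gapExcess, longGapCount, card_filter, mul_sum, ← sum_add_distrib, sum_filter]
  refine sum_congr rfl fun m _ => ?_
  split_ifs <;> omega

/-! ### Asymptotics -/

theorem tendsto_windowLength_div {μ : ℝ} (hμ : 0 ≤ μ) :
    Tendsto (fun x => (windowLength μ x : ℝ) / x) atTop (𝓝 0) := by
  simpa using tendsto_windowLength_pow_div hμ 1

/-- The limiting bound is `exp (-μ)` for every `μ > 0`, hence arbitrarily small. -/
theorem tendsto_sub_lastPrime_div (hHL : HardyLittlewoodConjecture) :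
    Tendsto (fun x : ℝ => ((⌊x⌋₊ - lastPrime ⌊x⌋₊ : ℕ) : ℝ) / x) atTop (𝓝 0) := by
  refine tendsto_order.2 ⟨fun a ha => ?_, fun a ha => ?_⟩
  · filter_upwards [eventually_ge_atTop 0] with x hx
    exact ha.trans_le (by positivity)
  · obtain ⟨μ, hμa, hμ⟩ := ((Real.tendsto_exp_neg_atTop_nhds_zero.eventually_lt_const
      ha).and (eventually_gt_atTop 0)).exists
    have hlim := (tendsto_emptyWindowCount hHL hμ).add (tendsto_windowLength_div hμ.le)
    rw [add_zero] at hlim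
    filter_upwards [hlim.eventually_lt_const hμa, eventually_gt_atTop 0] with x hx hx0
    refine lt_of_le_of_lt ?_ hx
    rw [← add_div]
    gcongr
    exact_mod_cast sub_lastPrime_le (N := ⌊x⌋₊) (windowLength μ x)

theorem tendsto_gapExcess (hHL : HardyLittlewoodConjecture) {μ : ℝ} (hμ : 0 < μ) :
    Tendsto (fun x : ℝ => (gapExcess ⌊x⌋₊ (windowLength μ x) : ℝ) / x) atTop
      (𝓝 (Real.exp (-μ))) := by
  have hZ := tendsto_emptyWindowCount hHL hμ
  have hL : Tendsto (fun x : ℝ => (emptyWindowCount μ x : ℝ) / x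
      - (((⌊x⌋₊ - lastPrime ⌊x⌋₊ : ℕ) : ℝ) / x + 2 / x)) atTop (𝓝 (Real.exp (-μ))) := by
    simpa using hZ.sub ((tendsto_sub_lastPrime_div hHL).add
      ((tendsto_const_nhds (x := (2 : ℝ))).div_atTop tendsto_id))
  refine tendsto_of_tendsto_of_tendsto_of_le_of_le' hL hZ ?_ ?_
  · filter_upwards [eventually_ge_atTop 2] with x hx
    have hN : 2 ≤ ⌊x⌋₊ := Nat.le_floor (by exact_mod_cast hx)
    have h := card_emptyWindow_le hN (windowLength μ x)
    have h' : (emptyWindowCount μ x : ℝ) ≤ gapExcess ⌊x⌋₊ (windowLength μ x)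
        + (((⌊x⌋₊ - lastPrime ⌊x⌋₊ : ℕ) : ℝ) + 2) := by exact_mod_cast h
    rw [← add_div, ← sub_div]
    gcongr
    linarith
  · filter_upwards [eventually_ge_atTop 2] with x hx
    have hN : 2 ≤ ⌊x⌋₊ := Nat.le_floor (by exact_mod_cast hx)
    gcongr
    exact_mod_cast gapExcess_le hN (windowLength μ x)

theorem tendsto_exp_neg_slope (μ : ℝ) :
    Tendsto (fun t => (Real.exp (-t) - Real.exp (-μ)) / (μ - t)) (𝓝[≠] μ)
      (𝓝 (Real.exp (-μ))) := by
  have h : HasDerivAt (fun t => Real.exp (-t)) (-Real.exp (-μ)) μ := by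
    simpa using (hasDerivAt_neg μ).exp
  have h1 := (hasDerivAt_iff_tendsto_slope.1 h).neg
  rw [neg_neg] at h1
  refine h1.congr fun t => ?_
  rw [slope_def_field, ← div_neg, neg_sub]

theorem tendsto_gapExcess_sub_div (hHL : HardyLittlewoodConjecture) {μ μ' : ℝ} (hμ : 0 < μ)
    (hμ' : μ < μ') :
    Tendsto (fun x : ℝ => (((gapExcess ⌊x⌋₊ (windowLength μ x) : ℝ)
        - gapExcess ⌊x⌋₊ (windowLength μ' x)) / x)
        / (((windowLength μ' x : ℝ) - windowLength μ x) / Real.log x)) atTop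
      (𝓝 ((Real.exp (-μ) - Real.exp (-μ')) / (μ' - μ))) := by
  have h1 := (tendsto_gapExcess hHL hμ).sub (tendsto_gapExcess hHL (hμ.trans hμ'))
  have h2 := (tendsto_windowLength_div_log (hμ.trans hμ').le).sub
    (tendsto_windowLength_div_log hμ.le)
  refine (h1.div h2 (sub_ne_zero.2 hμ'.ne')).congr fun x => ?_
  simp only [Pi.div_apply, sub_div]

theorem eventually_windowLength_lt {μ μ' : ℝ} (hμ : 0 < μ) (hμ' : μ < μ') :
    ∀ᶠ x in atTop, windowLength μ x < windowLength μ' x := by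
  have h2 := (tendsto_windowLength_div_log (hμ.trans hμ').le).sub
    (tendsto_windowLength_div_log hμ.le)
  filter_upwards [h2.eventually_const_lt (sub_pos.2 hμ'), eventually_gt_atTop 1] with x hx hx1
  have h3 := (div_lt_div_iff_of_pos_right (Real.log_pos hx1)).1 (sub_pos.1 hx)
  exact_mod_cast h3

/-- Difference quotients of the excess between `μ` and `t` bound the count from below for `t > μ`
and from above for `t < μ`. After `x → ∞` they become those of `exp (-μ)`, and `t` close to `μ`
gives its derivative. -/
theorem tendsto_longGapCount (hHL : HardyLittlewoodConjecture) {μ : ℝ} (hμ : 0 < μ) :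
    Tendsto (fun x : ℝ => (longGapCount ⌊x⌋₊ (windowLength μ x) : ℝ) * Real.log x / x) atTop
      (𝓝 (Real.exp (-μ))) := by
  have hslope := tendsto_exp_neg_slope μ
  refine tendsto_order.2 ⟨fun a ha => ?_, fun a ha => ?_⟩
  · obtain ⟨t, ht1, ht2⟩ := (((hslope.mono_left (nhdsWithin_mono μ
      (s := Set.Ioi μ) fun _ h => ne_of_gt h)).eventually_const_lt ha).and
        self_mem_nhdsWithin).exists
    have ht2' : μ < t := ht2
    rw [← neg_div_neg_eq, neg_sub, neg_sub] at ht1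
    filter_upwards [(tendsto_gapExcess_sub_div hHL hμ ht2').eventually_const_lt ht1,
      eventually_windowLength_lt hμ ht2', eventually_gt_atTop 1] with x h1 h2 h3
    have hl := Real.log_pos h3
    have hx0 : 0 < x := by linarith
    refine h1.trans_le ?_
    have h4 : (gapExcess ⌊x⌋₊ (windowLength μ x) : ℝ) ≤ gapExcess ⌊x⌋₊ (windowLength t x)
        + ((windowLength t x : ℝ) - windowLength μ x)
          * longGapCount ⌊x⌋₊ (windowLength μ x) := by
      rw [← Nat.cast_sub h2.le]
      exact_mod_cast gapExcess_le_add ⌊x⌋₊ h2.le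
    have h5 : (0 : ℝ) < (windowLength t x : ℝ) - windowLength μ x :=
      sub_pos.2 (by exact_mod_cast h2)
    rw [div_le_iff₀ (by positivity), show (longGapCount ⌊x⌋₊ (windowLength μ x) : ℝ) * Real.log x
      / x * (((windowLength t x : ℝ) - windowLength μ x) / Real.log x)
      = ((windowLength t x : ℝ) - windowLength μ x) * longGapCount ⌊x⌋₊ (windowLength μ x) / x by
        field_simp]
    gcongr
    linarith
  · obtain ⟨t, ⟨ht1, ht2⟩, ht3⟩ := ((((hslope.mono_left (nhdsWithin_mono μ
      (s := Set.Iio μ) fun _ h => ne_of_lt h)).eventually_lt_const ha).and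
        self_mem_nhdsWithin).and (mem_nhdsWithin_of_mem_nhds (Ioi_mem_nhds hμ))).exists
    have ht2' : t < μ := ht2
    have ht3' : 0 < t := ht3
    filter_upwards [(tendsto_gapExcess_sub_div hHL ht3' ht2').eventually_lt_const ht1,
      eventually_windowLength_lt ht3' ht2', eventually_gt_atTop 1] with x h1 h2 h3
    have hl := Real.log_pos h3
    have hx0 : 0 < x := by linarith
    refine lt_of_le_of_lt ?_ h1
    have h4 : (gapExcess ⌊x⌋₊ (windowLength μ x) : ℝ)
        + ((windowLength μ x : ℝ) - windowLength t x) * longGapCount ⌊x⌋₊ (windowLength μ x)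
        ≤ gapExcess ⌊x⌋₊ (windowLength t x) := by
      rw [← Nat.cast_sub h2.le]
      exact_mod_cast add_le_gapExcess ⌊x⌋₊ h2.le
    have h5 : (0 : ℝ) < (windowLength μ x : ℝ) - windowLength t x :=
      sub_pos.2 (by exact_mod_cast h2)
    rw [le_div_iff₀ (by positivity), show (longGapCount ⌊x⌋₊ (windowLength μ x) : ℝ) * Real.log x
      / x * (((windowLength μ x : ℝ) - windowLength t x) / Real.log x)
      = ((windowLength μ x : ℝ) - windowLength t x) * longGapCount ⌊x⌋₊ (windowLength μ x) / x by
        field_simp]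
    gcongr
    linarith

/-- The sum of the gaps exceeding `h` between consecutive primes up to `N`. -/
noncomputable def longGapSum (N h : ℕ) : ℕ :=
  ∑ m ∈ range (N.primeCounting - 1) with h < prime (m + 1) - prime m, (prime (m + 1) - prime m)

theorem tendsto_longGapSum (hHL : HardyLittlewoodConjecture) {μ : ℝ} (hμ : 0 < μ) :
    Tendsto (fun x : ℝ => (longGapSum ⌊x⌋₊ (windowLength μ x) : ℝ) / x) atTop
      (𝓝 ((1 + μ) * Real.exp (-μ))) := by
  have h := (tendsto_gapExcess hHL hμ).add
    ((tendsto_windowLength_div_log hμ.le).mul (tendsto_longGapCount hHL hμ))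
  rw [show (1 + μ) * Real.exp (-μ) = Real.exp (-μ) + μ * Real.exp (-μ) by ring]
  refine h.congr' ?_
  filter_upwards [eventually_gt_atTop 1] with x hx
  have hl := (Real.log_pos hx).ne'
  rw [longGapSum, sum_longGap_eq]
  push_cast
  field_simp

/-- Sandwich for a quantity that decreases with the threshold: compare with fixed multiples of `log
x` on both sides of `l` and use continuity of the limit. -/
theorem tendsto_of_eventually_le_of_le {F g : ℝ → ℝ} {A : ℝ → ℝ → ℝ} {l : ℝ} (hl : 0 < l)
    (hg : ContinuousAt g l) (hA : ∀ μ, 0 < μ → Tendsto (A μ) atTop (𝓝 (g μ)))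
    (hle : ∀ μ, 0 < μ → μ < l → ∀ᶠ x in atTop, F x ≤ A μ x)
    (hge : ∀ μ, l < μ → ∀ᶠ x in atTop, A μ x ≤ F x) : Tendsto F atTop (𝓝 (g l)) := by
  refine tendsto_order.2 ⟨fun a ha => ?_, fun a ha => ?_⟩
  · obtain ⟨t, ht1, ht2⟩ := (((hg.tendsto.mono_left nhdsWithin_le_nhds).eventually_const_lt ha).and
      (self_mem_nhdsWithin (s := Set.Ioi l))).exists
    have ht2' : l < t := ht2
    filter_upwards [(hA t (hl.trans ht2')).eventually_const_lt ht1, hge t ht2'] with x h1 h2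
    exact h1.trans_le h2
  · obtain ⟨t, ⟨ht1, ht2⟩, ht3⟩ :=
      ((((hg.tendsto.mono_left nhdsWithin_le_nhds).eventually_lt_const ha).and
        (self_mem_nhdsWithin (s := Set.Iio l))).and
        (mem_nhdsWithin_of_mem_nhds (Ioi_mem_nhds hl))).exists
    filter_upwards [(hA t ht3).eventually_lt_const ht1, hle t ht3 ht2] with x h1 h2
    exact h2.trans_lt h1

theorem mem_largeGaps_iff {x H : ℝ} (hx : 0 ≤ x) {m : ℕ} :
    m ∈ (largeGaps_finite x H).toFinset ↔
      m ∈ range (⌊x⌋₊.primeCounting - 1) ∧ H ≤ ((prime (m + 1) - prime m : ℕ) : ℝ) := by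
  rw [Set.Finite.mem_toFinset, mem_range, Nat.cast_sub (prime_lt_prime_succ m).le]
  change ((prime (m + 1) : ℝ) ≤ x ∧ _) ↔ _
  rw [← Nat.le_floor_iff hx, prime_le_iff]
  exact and_congr_left fun _ => by omega

/-- The strict inequality between `μ log x` and `H`, here and in `subset_largeGaps`, absorbs both
the integer part and the passage between `≥ H` and `> h`. -/
theorem largeGaps_subset {x H μ : ℝ} (hx : 1 ≤ x) (hμ : 0 ≤ μ) (hH : μ * Real.log x < H) :
    (largeGaps_finite x H).toFinset ⊆ {m ∈ range (⌊x⌋₊.primeCounting - 1) |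
      windowLength μ x < prime (m + 1) - prime m} := by
  intro m hm
  obtain ⟨h1, h2⟩ := (mem_largeGaps_iff (by linarith)).1 hm
  refine mem_filter.2 ⟨h1, ?_⟩
  have := windowLength_le hμ hx
  have h3 : (windowLength μ x : ℝ) < ((prime (m + 1) - prime m : ℕ) : ℝ) := by linarith
  exact_mod_cast h3

theorem subset_largeGaps {x H μ : ℝ} (hx : 1 ≤ x) (hH : H < μ * Real.log x) :
    {m ∈ range (⌊x⌋₊.primeCounting - 1) | windowLength μ x < prime (m + 1) - prime m}
      ⊆ (largeGaps_finite x H).toFinset := by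
  intro m hm
  obtain ⟨h1, h2⟩ := mem_filter.1 hm
  refine (mem_largeGaps_iff (by linarith)).2 ⟨h1, hH.le.trans ?_⟩
  exact (Nat.lt_of_floor_lt h2).le

theorem gapSum_eq (x H : ℝ) :
    gapSum x H = ∑ m ∈ (largeGaps_finite x H).toFinset,
      ((prime (m + 1) - prime m : ℕ) : ℝ) :=
  sum_congr rfl fun m _ => (Nat.cast_sub (prime_lt_prime_succ m).le).symm

theorem eventually_mul_log_lt {l μ : ℝ} (hl : 0 < l) {H : ℝ → ℝ}
    (hH : H ~[atTop] fun x => l * Real.log x) (hμ : μ < l) :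
    ∀ᶠ x in atTop, μ * Real.log x < H x := by
  have hv : ∀ᶠ x : ℝ in atTop, l * Real.log x ≠ 0 := by
    filter_upwards [eventually_gt_atTop 1] with x hx
    exact mul_ne_zero hl.ne' (Real.log_pos hx).ne'
  have h := (isEquivalent_iff_tendsto_one hv).1 hH
  filter_upwards [h.eventually_const_lt ((div_lt_one hl).2 hμ), eventually_gt_atTop 1] with x hx hx1
  have h1 := Real.log_pos hx1
  rw [Pi.div_apply, lt_div_iff₀ (by positivity)] at hx
  refine lt_of_eq_of_lt ?_ hx
  field_simp

theorem eventually_lt_mul_log {l μ : ℝ} (hl : 0 < l) {H : ℝ → ℝ}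
    (hH : H ~[atTop] fun x => l * Real.log x) (hμ : l < μ) :
    ∀ᶠ x in atTop, H x < μ * Real.log x := by
  have hv : ∀ᶠ x : ℝ in atTop, l * Real.log x ≠ 0 := by
    filter_upwards [eventually_gt_atTop 1] with x hx
    exact mul_ne_zero hl.ne' (Real.log_pos hx).ne'
  have h := (isEquivalent_iff_tendsto_one hv).1 hH
  filter_upwards [h.eventually_lt_const ((one_lt_div hl).2 hμ), eventually_gt_atTop 1] with x hx hx1
  have h1 := Real.log_pos hx1
  rw [Pi.div_apply, div_lt_iff₀ (by positivity)] at hx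
  refine lt_of_lt_of_eq hx ?_
  field_simp

theorem tendsto_gapCount (hHL : HardyLittlewoodConjecture) {l : ℝ} (hl : 0 < l) {H : ℝ → ℝ}
    (hH : H ~[atTop] fun x => l * Real.log x) :
    Tendsto (fun x => gapCount x (H x) * Real.log x / x) atTop (𝓝 (Real.exp (-l))) := by
  have e : ∀ x, gapCount x (H x) = #(largeGaps_finite x (H x)).toFinset := fun x => by
    simp [gapCount]
  refine tendsto_of_eventually_le_of_le (g := fun t => Real.exp (-t)) hl (by fun_prop)
    (fun μ hμ => tendsto_longGapCount hHL hμ) (fun μ hμ hμl => ?_) fun μ hμ => ?_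
  · filter_upwards [eventually_mul_log_lt hl hH hμl, eventually_ge_atTop 1] with x hx hx1
    have := Real.log_nonneg hx1
    rw [e]
    gcongr
    exact card_le_card (largeGaps_subset hx1 hμ.le hx)
  · filter_upwards [eventually_lt_mul_log hl hH hμ, eventually_ge_atTop 1] with x hx hx1
    have := Real.log_nonneg hx1
    rw [e]
    gcongr
    exact card_le_card (subset_largeGaps hx1 hx)

theorem tendsto_gapSum (hHL : HardyLittlewoodConjecture) {l : ℝ} (hl : 0 < l) {H : ℝ → ℝ}
    (hH : H ~[atTop] fun x => l * Real.log x) :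
    Tendsto (fun x => gapSum x (H x) / x) atTop (𝓝 ((1 + l) * Real.exp (-l))) := by
  refine tendsto_of_eventually_le_of_le (g := fun t => (1 + t) * Real.exp (-t)) hl (by fun_prop)
    (fun μ hμ => tendsto_longGapSum hHL hμ) (fun μ hμ hμl => ?_) fun μ hμ => ?_
  · filter_upwards [eventually_mul_log_lt hl hH hμl, eventually_ge_atTop 1] with x hx hx1
    rw [gapSum_eq, longGapSum, Nat.cast_sum]
    gcongr
    exact largeGaps_subset hx1 hμ.le hx
  · filter_upwards [eventually_lt_mul_log hl hH hμ, eventually_ge_atTop 1] with x hx hx1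
    rw [gapSum_eq, longGapSum, Nat.cast_sum]
    gcongr
    exact subset_largeGaps hx1 hx

end PrimeGaps

theorem theorem2 (hHL : PrimeGaps.HardyLittlewoodConjecture)
    (lam : ℝ) (hlam : 0 < lam) (H : ℝ → ℝ)
    (hH : Asymptotics.IsEquivalent Filter.atTop H (fun x => lam * Real.log x)) :
    Asymptotics.IsEquivalent Filter.atTop
        (fun x : ℝ => PrimeGaps.gapCount x (H x))
        (fun x : ℝ => Real.exp (-lam) * (x / Real.log x)) ∧
      Asymptotics.IsEquivalent Filter.atTop
        (fun x : ℝ => PrimeGaps.gapSum x (H x))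
        (fun x : ℝ => (1 + lam) * Real.exp (-lam) * x) := by
  have he := Real.exp_pos (-lam)
  constructor
  · have hv : ∀ᶠ x : ℝ in atTop, Real.exp (-lam) * (x / Real.log x) ≠ 0 := by
      filter_upwards [eventually_gt_atTop 1] with x hx
      have := Real.log_pos hx
      positivity
    refine (isEquivalent_iff_tendsto_one hv).2 ?_
    have h := (PrimeGaps.tendsto_gapCount hHL hlam hH).div_const (Real.exp (-lam))
    rw [div_self he.ne'] at h
    refine h.congr fun x => ?_
    simp only [Pi.div_apply]
    rw [div_mul_eq_div_div_swap, div_div_eq_mul_div]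
  · have hv : ∀ᶠ x : ℝ in atTop, (1 + lam) * Real.exp (-lam) * x ≠ 0 := by
      filter_upwards [eventually_gt_atTop 1] with x hx
      positivity
    refine (isEquivalent_iff_tendsto_one hv).2 ?_
    have h := (PrimeGaps.tendsto_gapSum hHL hlam hH).div_const ((1 + lam) * Real.exp (-lam))
    rw [div_self (by positivity)] at h
    refine h.congr fun x => ?_
    simp only [Pi.div_apply]
    rw [div_div, mul_comm x]
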